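/- Let the cake be $C=[0,1]$, and let the valuation of each agent be a finite nonatomic Borel measure on $C$. Consider deterministic programs, each a fixed finite text that does not depend on the number of agents, on a real random-access machine. The machine has natural-number memory cells (constants, addition, truncated subtraction, comparison, use as array indices) and real memory cells (rational constants, conversion of naturals to reals, $+,-,\times,\div$, comparison), and programs are built by sequencing, conditionals and while-loops. The input is the number $n$ of agents. The valuations are accessible only through two kinds of queries: an evaluation query $(i,x,y)$, answered by $V_i([x,y]\cap C)$, and a mark query $(i,x,a)$, answered by the leftmost $y\in[0,1]$ with $y\ge x$ and $V_i([x,y]\cap C)\ge a$ (and by $1$ if there is none). The program hands over intervals to agents, and the share of an agent is the union of the intervals handed over to it (an interval from $x$ to $y$ contains $x$ but not $y$, except that a nondegenerate interval ending at $1$ contains $1$). Each arithmetic operation, comparison, memory access, query and command takes one unit of time. Then there are such a program $P$ and a polynomial $p$ with natural-number coefficients such that, for every $n\ge 1$ and all valuations $V_1,\dots,V_n$: (1) (polynomial time) $P$ halts after at most $p(n)$ units of time; (2) (entire cake) the shares $Z_1,\dots,Z_n$ are a partition of the entire cake: $C=Z_1\,\dot\cup\,\cdots\,\dot\cup\,Z_n$;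 (3) (proportionality) $V_i(Z_i)\ge V_i(C)/n$ for every $i$; (4) (symmetry) the value that each agent receives does not depend on the order of the agents: for every permutation $\sigma$ of $\{1,\dots,n\}$, if $P$ is run on $V_{\sigma(1)},\dots,V_{\sigma(n)}$ and yields the shares $Z'_1,\dots,Z'_n$, then $V_{\sigma(j)}(Z'_j)=V_{\sigma(j)}(Z_{\sigma(j)})$ for every $j$. In particular, the numbers of queries and of arithmetic operations are polynomial in $n$ (the property asked for by Chèze). -/

import Mathlib

open MeasureTheory Set

noncomputable section

namespace CakeCutting

/-! The cake is the unit interval `[0,1]` (Mathlib's `unitInterval`).  The valuation of an agent is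
a measure on it. -/

/-- Answer to the query "how much is the interval `[x, y]` worth to you?". -/
def evalQuery (μ : Measure unitInterval) (x y : ℝ) : ℝ :=
  μ.real {t : unitInterval | x ≤ (t : ℝ) ∧ (t : ℝ) ≤ y}

/-- Answer to the query "make a mark `y` such that `[x, y]` is worth `a` to you": the leftmost
`y ∈ [0,1]`, `y ≥ x`, for which `[x, y]` is worth at least `a` (for a nonatomic measure, its value
is then exactly `a` when `0 ≤ a`), and `1` if there is no such `y`. -/
def markQuery (μ : Measure unitInterval) (x a : ℝ) : ℝ :=
  sInf ({y : ℝ | 0 ≤ y ∧ y ≤ 1 ∧ x ≤ y ∧ a ≤ evalQuery μ x y} ∪ {1})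

/-! ### A real random-access machine with query access to the agents

A program is a finite piece of text that does not depend on the number of agents. It has natural
number cells and real number cells, each addressed by an array name and two computed indices.
Natural numbers can be added, subtracted (truncated at `0`) and compared; there is no unit-cost
multiplication of naturals. Real numbers can be added, subtracted, multiplied, divided and compared;
there is no rounding from reals to naturals. The agents are accessible only through queries. -/

/-- Expressions with a natural number value. -/
inductive NatExpr where
  | const (k : ℕ)
  | get (a : ℕ) (i j : NatExpr)
  | add (e f : NatExpr)
  | sub (e f : NatExpr)

/-- Expressions with a real value; `eval i x y` and `mark i x a` ask agent number `i`. -/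
inductive RealExpr where
  | const (q : ℚ)
  | ofNat (e : NatExpr)
  | get (a : ℕ) (i j : NatExpr)
  | add (e f : RealExpr)
  | sub (e f : RealExpr)
  | mul (e f : RealExpr)
  | div (e f : RealExpr)
  | eval (i : NatExpr) (x y : RealExpr)
  | mark (i : NatExpr) (x a : RealExpr)

/-- Tests. -/
inductive Test where
  | natLe (e f : NatExpr)
  | realLe (e f : RealExpr)
  | not (b : Test)
  | and (b c : Test)

/-- Programs. The command `give i x y` hands the interval from `x` to `y` over to agent `i`. -/
inductive Program where
  | skip
  | setNat (a : ℕ) (i j : NatExpr) (e : NatExpr)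
  | setReal (a : ℕ) (i j : NatExpr) (e : RealExpr)
  | give (i : NatExpr) (x y : RealExpr)
  | seq (P Q : Program)
  | ite (b : Test) (P Q : Program)
  | loop (b : Test) (P : Program)

/-- Memory contents, together with the list of the intervals handed over so far. -/
structure State where
  nat : ℕ → ℕ → ℕ → ℕ
  real : ℕ → ℕ → ℕ → ℝ
  given : List (ℕ × ℝ × ℝ)

/-- At the start, natural cell `(0, 0, 0)` holds the number of agents, all other cells hold `0`,
and nothing has been handed over. -/
def State.init (n : ℕ) : State where
  nat := fun a i j => if a = 0 ∧ i = 0 ∧ j = 0 then n else 0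
  real := fun _ _ _ => 0
  given := []

def State.setNat (s : State) (a i j v : ℕ) : State :=
  { s with nat := fun a' i' j' => if a' = a ∧ i' = i ∧ j' = j then v else s.nat a' i' j' }

def State.setReal (s : State) (a i j : ℕ) (v : ℝ) : State :=
  { s with real := fun a' i' j' => if a' = a ∧ i' = i ∧ j' = j then v else s.real a' i' j' }

def State.give (s : State) (i : ℕ) (x y : ℝ) : State :=
  { s with given := s.given ++ [(i, x, y)] }

/-- Value of an expression. -/
def NatExpr.val (s : State) : NatExpr → ℕ
  | const k => k
  | get a i j => s.nat a (i.val s) (j.val s)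
  | add e f => e.val s + f.val s
  | sub e f => e.val s - f.val s

/-- Value of an expression; `V` lists the valuations of the agents. A query to a nonexistent agent
is answered by `0`. -/
def RealExpr.val {n : ℕ} (V : Fin n → Measure unitInterval) (s : State) : RealExpr → ℝ
  | const q => (q : ℝ)
  | ofNat e => (e.val s : ℝ)
  | get a i j => s.real a (i.val s) (j.val s)
  | add e f => e.val V s + f.val V s
  | sub e f => e.val V s - f.val V s
  | mul e f => e.val V s * f.val V s
  | div e f => e.val V s / f.val V s
  | eval i x y =>
      if h : i.val s < n then evalQuery (V ⟨i.val s, h⟩) (x.val V s) (y.val V s) else 0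
  | mark i x a =>
      if h : i.val s < n then markQuery (V ⟨i.val s, h⟩) (x.val V s) (a.val V s) else 0

/-- Truth of a test. -/
def Test.Holds {n : ℕ} (V : Fin n → Measure unitInterval) (s : State) : Test → Prop
  | natLe e f => e.val s ≤ f.val s
  | realLe e f => e.val V s ≤ f.val V s
  | not b => ¬ b.Holds V s
  | and b c => b.Holds V s ∧ c.Holds V s

/-! Every constant, memory access, arithmetic operation, comparison, connective and query costs one
unit of time. -/

def NatExpr.cost : NatExpr → ℕ
  | const _ => 1
  | get _ i j => i.cost + j.cost + 1
  | add e f => e.cost + f.cost + 1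
  | sub e f => e.cost + f.cost + 1

def RealExpr.cost : RealExpr → ℕ
  | const _ => 1
  | ofNat e => e.cost + 1
  | get _ i j => i.cost + j.cost + 1
  | add e f => e.cost + f.cost + 1
  | sub e f => e.cost + f.cost + 1
  | mul e f => e.cost + f.cost + 1
  | div e f => e.cost + f.cost + 1
  | eval i x y => i.cost + x.cost + y.cost + 1
  | mark i x a => i.cost + x.cost + a.cost + 1

def Test.cost : Test → ℕ
  | natLe e f => e.cost + f.cost + 1
  | realLe e f => e.cost + f.cost + 1
  | not b => b.cost + 1
  | and b c => b.cost + c.cost + 1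

/-- `Exec V P s s' t`: with agents `V`, program `P` started in state `s` halts in state `s'` after
time `t`. -/
inductive Exec {n : ℕ} (V : Fin n → Measure unitInterval) :
    Program → State → State → ℕ → Prop where
  | skip (s : State) : Exec V .skip s s 1
  | setNat (a : ℕ) (i j e : NatExpr) (s : State) :
      Exec V (.setNat a i j e) s (s.setNat a (i.val s) (j.val s) (e.val s))
        (i.cost + j.cost + e.cost + 1)
  | setReal (a : ℕ) (i j : NatExpr) (e : RealExpr) (s : State) :
      Exec V (.setReal a i j e) s (s.setReal a (i.val s) (j.val s) (e.val V s))
        (i.cost + j.cost + e.cost + 1)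
  | give (i : NatExpr) (x y : RealExpr) (s : State) :
      Exec V (.give i x y) s (s.give (i.val s) (x.val V s) (y.val V s))
        (i.cost + x.cost + y.cost + 1)
  | seq {P Q : Program} {s₁ s₂ s₃ : State} {t u : ℕ} :
      Exec V P s₁ s₂ t → Exec V Q s₂ s₃ u → Exec V (.seq P Q) s₁ s₃ (t + u + 1)
  | iteTrue {b : Test} {P Q : Program} {s s' : State} {t : ℕ} :
      b.Holds V s → Exec V P s s' t → Exec V (.ite b P Q) s s' (b.cost + t + 1)
  | iteFalse {b : Test} {P Q : Program} {s s' : State} {t : ℕ} :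
      ¬ b.Holds V s → Exec V Q s s' t → Exec V (.ite b P Q) s s' (b.cost + t + 1)
  | loopTrue {b : Test} {P : Program} {s₁ s₂ s₃ : State} {t u : ℕ} :
      b.Holds V s₁ → Exec V P s₁ s₂ t → Exec V (.loop b P) s₂ s₃ u →
      Exec V (.loop b P) s₁ s₃ (b.cost + t + u + 1)
  | loopFalse {b : Test} {P : Program} {s : State} :
      ¬ b.Holds V s → Exec V (.loop b P) s s (b.cost + 1)

/-- Programs are deterministic: the final state and the running time are unique. -/
theorem Exec.deterministic {n : ℕ} {V : Fin n → Measure unitInterval} {P : Program}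
    {s s₁ s₂ : State} {t₁ t₂ : ℕ} (h₁ : Exec V P s s₁ t₁) (h₂ : Exec V P s s₂ t₂) :
    s₁ = s₂ ∧ t₁ = t₂ := by
  induction h₁ generalizing s₂ t₂ with
  | skip | setNat | setReal | give => cases h₂; exact ⟨rfl, rfl⟩
  | seq _ _ ih₁ ih₂ =>
    cases h₂ with
    | seq h h' =>
      obtain ⟨rfl, rfl⟩ := ih₁ h
      obtain ⟨rfl, rfl⟩ := ih₂ h'
      exact ⟨rfl, rfl⟩
  | iteTrue hb _ ih =>
    cases h₂ with
    | iteTrue _ h => obtain ⟨rfl, rfl⟩ := ih h; exact ⟨rfl, rfl⟩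
    | iteFalse hb' _ => exact absurd hb hb'
  | iteFalse hb _ ih =>
    cases h₂ with
    | iteTrue hb' _ => exact absurd hb' hb
    | iteFalse _ h => obtain ⟨rfl, rfl⟩ := ih h; exact ⟨rfl, rfl⟩
  | loopTrue hb _ _ ih₁ ih₂ =>
    cases h₂ with
    | loopTrue _ h h' =>
      obtain ⟨rfl, rfl⟩ := ih₁ h
      obtain ⟨rfl, rfl⟩ := ih₂ h'
      exact ⟨rfl, rfl⟩
    | loopFalse hb' => exact absurd hb hb'
  | loopFalse hb =>
    cases h₂ with
    | loopTrue hb' _ _ => exact absurd hb' hb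
    | loopFalse _ => exact ⟨rfl, rfl⟩

/-! ### Allocations -/

/-- The piece of cake between `x` and `y`: the half-open interval `[x, y)`, to which the right
endpoint `1` of the cake is added when the interval is nondegenerate and reaches it. -/
def piece (x y : ℝ) : Set unitInterval :=
  {t | x ≤ (t : ℝ) ∧ (t : ℝ) < y ∨ x < y ∧ y = 1 ∧ (t : ℝ) = 1}

/-- The share of agent `i`: the union of all pieces handed over to this agent. -/
def State.share (s : State) (i : ℕ) : Set unitInterval :=
  {p | ∃ x y : ℝ, (i, x, y) ∈ s.given ∧ p ∈ piece x y}

/-- `Allocates P V Z t`: run on the `n` agents `V`, program `P` halts after time `t` and the share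
of each agent `i` is `Z i`. -/
def Allocates {n : ℕ} (P : Program) (V : Fin n → Measure unitInterval)
    (Z : Fin n → Set unitInterval) (t : ℕ) : Prop :=
  ∃ s : State, Exec V P (State.init n) s t ∧ ∀ i : Fin n, Z i = s.share i

/-- A valuation is a finite nonatomic Borel measure on the cake. -/
def IsValuation (μ : Measure unitInterval) : Prop :=
  IsFiniteMeasure μ ∧ NullSingletonClass μ

/-- The shares are a partition of the entire cake. -/
def IsPartition {n : ℕ} (Z : Fin n → Set unitInterval) : Prop :=
  (∀ i j, i ≠ j → Disjoint (Z i) (Z j)) ∧ ⋃ i, Z i = univ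

/-- Each agent gets at least `1/n` of its total value. -/
def IsProportional {n : ℕ} (V : Fin n → Measure unitInterval)
    (Z : Fin n → Set unitInterval) : Prop :=
  ∀ i, (V i).real univ / n ≤ (V i).real (Z i)

/-- Running `P` on the agents `V` and running it on the same agents in another order, with agent
`σ j` in position `j`, gives each agent the same value. -/
def IsSymmetric (P : Program) : Prop :=
  ∀ (n : ℕ) (V : Fin n → Measure unitInterval), 1 ≤ n → (∀ i, IsValuation (V i)) →
    ∀ (σ : Equiv.Perm (Fin n)) (Z Z' : Fin n → Set unitInterval) (t t' : ℕ),
      Allocates P V Z t → Allocates P (fun j => V (σ j)) Z' t' →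
        ∀ j, (V (σ j)).real (Z' j) = (V (σ j)).real (Z (σ j))

end CakeCutting

end

/-!
The protocol cuts off, from left to right, one piece for each agent. Let the cuts of an agent be the
points that divide the cake into `n` parts of equal value for this agent. In round `k` the agent
whose cut number `k + 1` is leftmost, among those not yet served, receives the part between its cuts
number `k` and `k + 1`. These regular pieces are disjoint, because an agent left over from round
`k - 1` has its cut number `k` no further left than the end of the piece allocated in that round,
and each is worth exactly `1 / n` of the cake to its owner. Hence proportionality holds whatever
becomes of the gaps between the pieces, and symmetry depends only on how the gaps are allocated.

Ties are broken by comparing the whole sequences of cuts lexicographically. Agents that are still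
tied have the same cuts, so the choice between them changes neither the pieces and gaps that arise
nor the multiset of the cuts of the agents that remain. Thus the gaps do not depend on the order of
the agents (`PickRun.perm`).

A gap `[a, b]` is divided among a coalition that is determined symmetrically. Starting with all
agents, one repeatedly asks the members of the coalition to cut `[a, b]` into as many equal parts as
there are members, and keeps only those with the lexicographically least cuts. A coalition that does
not shrink in one round never shrinks again, so that it is constant after `n` rounds
(`coalition_stable`). All its members then cut `[a, b]` into equal parts at the same points, and each
of them receives one of the parts; it is irrelevant which one, since all parts have the same value
for all members.

The program uses loops over `0, …, n - 1` only (`Code`). Such a program denotes a total function on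
states, and the machine computes this function in polynomial time (`Code.exec_compile`), so that the
correctness proof deals with functions rather than with executions.
-/

noncomputable section

namespace CakeCutting

/-! ### Programs with counting loops only -/

@[simp] theorem State.setNat_nat_self (s : State) (a i j v : ℕ) :
    (s.setNat a i j v).nat a i j = v := by
  simp [State.setNat]

@[simp] theorem State.setNat_nat_ne (s : State) {a a' : ℕ} (h : a' ≠ a) (i j v : ℕ) :
    (s.setNat a i j v).nat a' = s.nat a' := by
  funext i' j'; simp [State.setNat, h]

@[simp] theorem State.setNat_real (s : State) (a i j v : ℕ) :
    (s.setNat a i j v).real = s.real := rfl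

@[simp] theorem State.setNat_given (s : State) (a i j v : ℕ) :
    (s.setNat a i j v).given = s.given := rfl

@[simp] theorem State.setReal_nat (s : State) (a i j : ℕ) (v : ℝ) :
    (s.setReal a i j v).nat = s.nat := rfl

@[simp] theorem State.setReal_real_self (s : State) (a i j : ℕ) (v : ℝ) :
    (s.setReal a i j v).real a i j = v := by
  simp [State.setReal]

@[simp] theorem State.setReal_real_ne (s : State) {a a' : ℕ} (h : a' ≠ a) (i j : ℕ) (v : ℝ) :
    (s.setReal a i j v).real a' = s.real a' := by
  funext i' j'; simp [State.setReal, h]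

@[simp] theorem State.setReal_given (s : State) (a i j : ℕ) (v : ℝ) :
    (s.setReal a i j v).given = s.given := rfl

@[simp] theorem State.give_nat (s : State) (i : ℕ) (x y : ℝ) : (s.give i x y).nat = s.nat := rfl

@[simp] theorem State.give_real (s : State) (i : ℕ) (x y : ℝ) : (s.give i x y).real = s.real := rfl

@[simp] theorem State.give_given (s : State) (i : ℕ) (x y : ℝ) :
    (s.give i x y).given = s.given ++ [(i, x, y)] := rfl

/-- The natural number cell `(a, i, 0)`. -/
abbrev NatExpr.cell (a : ℕ) (i : NatExpr) : NatExpr := .get a i (.const 0)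

/-- The natural number cell `(a, 0, 0)`, used as a scalar variable. -/
abbrev NatExpr.var (a : ℕ) : NatExpr := .cell a (.const 0)

/-- The real number cell `(a, 0, 0)`, used as a scalar variable. -/
abbrev RealExpr.var (a : ℕ) : RealExpr := .get a (.const 0) (.const 0)

/-- Programs in which every loop is a counting loop: `forAll c P` executes `P` with
`c = 0, …, n - 1`, where `n` is the number of agents and `c` a scalar variable. Such programs
always halt, so that they denote total functions on states. -/
inductive Code where
  | setNat (a : ℕ) (i e : NatExpr)
  | setReal (a : ℕ) (e : RealExpr)
  | give (i : NatExpr) (x y : RealExpr)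
  | seq (P Q : Code)
  | onlyIf (b : Test) (P : Code)
  | forAll (c : ℕ) (P : Code)

namespace Code

scoped infixr:60 " ;; " => Code.seq

/-- The program for the machine. -/
def compile : Code → Program
  | setNat a i e => .setNat a i (.const 0) e
  | setReal a e => .setReal a (.const 0) (.const 0) e
  | give i x y => .give i x y
  | seq P Q => .seq P.compile Q.compile
  | onlyIf b P => .ite b P.compile .skip
  | forAll c P =>
    .seq (.setNat c (.const 0) (.const 0) (.const 0))
      (.loop (.natLe (.add (.var c) (.const 1)) (.var 0))
        (.seq P.compile
          (.setNat c (.const 0) (.const 0) (.add (.var c) (.const 1)))))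

open Classical in
/-- The final state as a function of the initial state. The counter of a loop is set to `n` at the
end of the loop. -/
def denote {n : ℕ} (V : Fin n → Measure unitInterval) : Code → State → State
  | setNat a i e, s => s.setNat a (i.val s) 0 (e.val s)
  | setReal a e, s => s.setReal a 0 0 (e.val V s)
  | give i x y, s => s.give (i.val s) (x.val V s) (y.val V s)
  | seq P Q, s => Q.denote V (P.denote V s)
  | onlyIf b P, s => if b.Holds V s then P.denote V s else s
  | forAll c P, s =>
    Nat.rec (motive := fun _ => State) (s.setNat c 0 0 0)
      (fun k s' => (P.denote V s').setNat c 0 0 (k + 1)) n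

/-- Whether the code can write to the array `a` of natural numbers. -/
def writesNat (a : ℕ) : Code → Bool
  | setNat a' _ _ => a == a'
  | setReal _ _ => false
  | give _ _ _ => false
  | seq P Q => P.writesNat a || Q.writesNat a
  | onlyIf _ P => P.writesNat a
  | forAll c P => a == c || P.writesNat a

/-- Whether the code can write to the array `a` of reals. -/
def writesReal (a : ℕ) : Code → Bool
  | setNat _ _ _ => false
  | setReal a' _ => a == a'
  | give _ _ _ => false
  | seq P Q => P.writesReal a || Q.writesReal a
  | onlyIf _ P => P.writesReal a
  | forAll _ P => P.writesReal a

/-- Whether the code can hand over pieces. -/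
def gives : Code → Bool
  | setNat _ _ _ => false
  | setReal _ _ => false
  | give _ _ _ => true
  | seq P Q => P.gives || Q.gives
  | onlyIf _ P => P.gives
  | forAll _ P => P.gives

/-- No loop changes its own counter, and no loop counter lies in array `0`, which holds `n`. -/
def wellFormed : Code → Bool
  | setNat _ _ _ => true
  | setReal _ _ => true
  | give _ _ _ => true
  | seq P Q => P.wellFormed && Q.wellFormed
  | onlyIf _ P => P.wellFormed
  | forAll c P => c != 0 && !P.writesNat c && P.wellFormed

/-- An upper bound on the running time, as a polynomial in the number of agents. Testing and
incrementing the counter of a loop costs `19` units per round; initializing the counter and leaving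
the loop costs `15`. -/
def bound : Code → Polynomial ℕ
  | setNat _ i e => .C (i.cost + 1 + e.cost + 1)
  | setReal _ e => .C (1 + 1 + e.cost + 1)
  | give i x y => .C (i.cost + x.cost + y.cost + 1)
  | seq P Q => P.bound + Q.bound + .C 1
  | onlyIf b P => .C (b.cost) + (P.bound + .C 1) + .C 1
  | forAll _ P => .X * (P.bound + .C 19) + .C 15

variable {n : ℕ} {V : Fin n → Measure unitInterval}

@[simp] theorem denote_seq (P Q : Code) (s : State) :
    (P ;; Q).denote V s = Q.denote V (P.denote V s) := rfl

/-- Proof rule for loops: an invariant `I`, indexed by the number of rounds completed. -/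
theorem denote_forAll (c : ℕ) (P : Code) (s : State) (I : ℕ → State → Prop)
    (h0 : I 0 (s.setNat c 0 0 0))
    (hs : ∀ k < n, ∀ s, s.nat c 0 0 = k → I k s → I (k + 1) ((P.denote V s).setNat c 0 0 (k + 1))) :
    I n ((forAll c P).denote V s) := by
  have key : ∀ k ≤ n, I k (Nat.rec (motive := fun _ => State) (s.setNat c 0 0 0)
      (fun k s' => (P.denote V s').setNat c 0 0 (k + 1)) k) := by
    intro k
    induction k with
    | zero => intro _; exact h0
    | succ k ih =>
      intro hk
      refine hs k hk _ ?_ (ih (by omega))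
      cases k <;> simp
  exact key n le_rfl

theorem denote_nat {a : ℕ} {P : Code} (h : P.writesNat a = false) (s : State) :
    (P.denote V s).nat a = s.nat a := by
  induction P generalizing s with
  | setNat a' i e =>
    have : a ≠ a' := by simpa [writesNat] using h
    simp [denote, this]
  | setReal a' e => rfl
  | give i x y => rfl
  | seq P Q ihP ihQ =>
    simp only [writesNat, Bool.or_eq_false_iff] at h
    simp [ihP h.1, ihQ h.2]
  | onlyIf b P ih =>
    rw [denote]; split_ifs
    · exact ih h s
    · rfl
  | forAll c P ih =>
    simp only [writesNat, Bool.or_eq_false_iff, beq_eq_false_iff_ne] at h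
    exact denote_forAll c P s (fun _ s' => s'.nat a = s.nat a) (by simp [h.1])
      (fun k _ s' _ hs' => by simp [h.1, ih h.2, hs'])

theorem denote_real {a : ℕ} {P : Code} (h : P.writesReal a = false) (s : State) :
    (P.denote V s).real a = s.real a := by
  induction P generalizing s with
  | setNat a' i e => rfl
  | setReal a' e =>
    have : a ≠ a' := by simpa [writesReal] using h
    simp [denote, this]
  | give i x y => rfl
  | seq P Q ihP ihQ =>
    simp only [writesReal, Bool.or_eq_false_iff] at h
    simp [ihP h.1, ihQ h.2]
  | onlyIf b P ih =>
    rw [denote]; split_ifs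
    · exact ih h s
    · rfl
  | forAll c P ih =>
    exact denote_forAll c P s (fun _ s' => s'.real a = s.real a) (by simp)
      (fun k _ s' _ hs' => by simp [ih h, hs'])

theorem denote_given {P : Code} (h : P.gives = false) (s : State) :
    (P.denote V s).given = s.given := by
  induction P generalizing s with
  | setNat a' i e => rfl
  | setReal a' e => rfl
  | give i x y => simp [gives] at h
  | seq P Q ihP ihQ =>
    simp only [gives, Bool.or_eq_false_iff] at h
    simp [ihP h.1, ihQ h.2]
  | onlyIf b P ih =>
    rw [denote]; split_ifs
    · exact ih h s
    · rfl
  | forAll c P ih =>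
    exact denote_forAll c P s (fun _ s' => s'.given = s.given) (by simp)
      (fun k _ s' _ hs' => by simp [ih h, hs'])

/-- The machine computes the denotation of a well-formed code within its time bound, provided that
the code leaves alone the cell that holds the number of agents. -/
theorem exec_compile {P : Code} (hP : P.wellFormed = true) (h0 : P.writesNat 0 = false)
    {s : State} (hs : s.nat 0 0 0 = n) :
    ∃ t, Exec V P.compile s (P.denote V s) t ∧ t ≤ P.bound.eval n := by
  induction P generalizing s with
  | setNat a i e => exact ⟨_, .setNat a i (.const 0) e s, by simp [bound, NatExpr.cost]⟩
  | setReal a e =>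
    exact ⟨_, .setReal a (.const 0) (.const 0) e s, by simp [bound, NatExpr.cost]⟩
  | give i x y => exact ⟨_, .give i x y s, by simp [bound]⟩
  | seq P Q ihP ihQ =>
    simp only [writesNat, Bool.or_eq_false_iff] at h0
    simp only [wellFormed, Bool.and_eq_true] at hP
    obtain ⟨t, ht, htb⟩ := ihP hP.1 h0.1 hs
    obtain ⟨u, hu, hub⟩ := ihQ hP.2 h0.2 (s := P.denote V s) (by rw [denote_nat h0.1, hs])
    refine ⟨_, .seq ht hu, ?_⟩
    simp [bound]; omega
  | onlyIf b P ih =>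
    obtain ⟨t, ht, htb⟩ := ih hP h0 hs
    by_cases hb : b.Holds V s
    · refine ⟨_, by simpa [compile, denote, hb] using Exec.iteTrue hb ht, ?_⟩
      simp [bound]; omega
    · refine ⟨_, by simpa [compile, denote, hb] using Exec.iteFalse hb (Exec.skip s), ?_⟩
      simp [bound]
  | forAll c P ih =>
    simp only [writesNat, Bool.or_eq_false_iff, beq_eq_false_iff_ne] at h0
    simp only [wellFormed, Bool.and_eq_true, bne_iff_ne, Bool.not_eq_true'] at hP
    set F : ℕ → State := fun k => Nat.rec (motive := fun _ => State) (s.setNat c 0 0 0)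
      (fun k s' => (P.denote V s').setNat c 0 0 (k + 1)) k with hF
    have hF0 : ∀ k, (F k).nat 0 0 0 = n := by
      intro k
      induction k with
      | zero => simp [hF, h0.1, hs]
      | succ k ihk => simpa [hF, h0.1, denote_nat h0.2] using ihk
    have hFc : ∀ k, (F k).nat c 0 0 = k := by
      intro k; cases k <;> simp [hF]
    -- `d` rounds are left
    have key : ∀ d k, k + d = n → ∃ t,
        Exec V (.loop (.natLe (.add (.var c) (.const 1)) (.var 0))
          (.seq P.compile (.setNat c (.const 0) (.const 0) (.add (.var c) (.const 1)))))
          (F k) (F n) t ∧ t ≤ d * (P.bound.eval n + 19) + 10 := by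
      intro d
      induction d with
      | zero =>
        intro k hk
        obtain rfl : k = n := by omega
        refine ⟨_, .loopFalse ?_, ?_⟩
        · simp [Test.Holds, NatExpr.val, hFc, hF0]
        · simp [Test.cost, NatExpr.cost]
      | succ d ihd =>
        intro k hk
        obtain ⟨t, ht, htb⟩ := ih hP.2 h0.2 (hF0 k)
        obtain ⟨u, hu, hub⟩ := ihd (k + 1) (by omega)
        have hinc : Exec V (.setNat c (.const 0) (.const 0) (.add (.var c) (.const 1)))
            (P.denote V (F k)) (F (k + 1)) 8 := by
          have := Exec.setNat (V := V) c (.const 0) (.const 0) (.add (.var c) (.const 1))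
            (P.denote V (F k))
          simpa [NatExpr.val, NatExpr.cost, denote_nat hP.1.2, hFc] using this
        refine ⟨_, .loopTrue ?_ (.seq ht hinc) hu, ?_⟩
        · simp [Test.Holds, NatExpr.val, hFc, hF0]; omega
        · simp [Test.cost, NatExpr.cost]; nlinarith
    obtain ⟨t, ht, htb⟩ := key n 0 (by omega)
    refine ⟨_, .seq (.setNat c (.const 0) (.const 0) (.const 0) s) ht, ?_⟩
    simp [bound, NatExpr.cost]; omega

end Code

end CakeCutting

namespace CakeCutting

/-! ### Queries to a nonatomic valuation -/

section Queries

variable (μ : Measure unitInterval)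

theorem evalQuery_nonneg (x y : ℝ) : 0 ≤ evalQuery μ x y := measureReal_nonneg

theorem evalQuery_zero_one : evalQuery μ 0 1 = μ.real univ := by
  unfold evalQuery
  congr 1
  ext t
  simp [t.2.1, t.2.2]

theorem le_markQuery {x a : ℝ} (hx : x ≤ 1) : x ≤ markQuery μ x a := by
  refine le_csInf ⟨1, by simp⟩ ?_
  rintro y (hy | rfl)
  · exact hy.2.2.1
  · exact hx

theorem markQuery_le {x a y : ℝ} (hx : 0 ≤ x) (hxy : x ≤ y) (hy : y ≤ 1)
    (h : a ≤ evalQuery μ x y) : markQuery μ x a ≤ y := by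
  refine csInf_le ⟨0, ?_⟩ (Or.inl ⟨hx.trans hxy, hy, hxy, h⟩)
  rintro z (hz | rfl)
  · exact hz.1
  · norm_num

theorem markQuery_le_one (x a : ℝ) : markQuery μ x a ≤ 1 := by
  refine csInf_le ⟨0, ?_⟩ (by simp)
  rintro z (hz | rfl)
  · exact hz.1
  · norm_num

theorem markQuery_mono (x : ℝ) {a b : ℝ} (hab : a ≤ b) : markQuery μ x a ≤ markQuery μ x b := by
  refine csInf_le_csInf ⟨0, ?_⟩ ⟨1, by simp⟩ ?_
  · rintro z (hz | rfl)
    · exact hz.1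
    · norm_num
  · rintro z (hz | hz)
    · exact Or.inl ⟨hz.1, hz.2.1, hz.2.2.1, hab.trans hz.2.2.2⟩
    · exact Or.inr hz

theorem markQuery_zero {x : ℝ} (hx : 0 ≤ x) (hx' : x ≤ 1) : markQuery μ x 0 = x :=
  le_antisymm (markQuery_le μ hx le_rfl hx' (evalQuery_nonneg μ x x)) (le_markQuery μ hx')

variable [NullSingletonClass μ]

theorem ae_coe_ne (y : ℝ) : ∀ᵐ t : unitInterval ∂μ, (t : ℝ) ≠ y := by
  rw [ae_iff]
  refine Set.Subsingleton.measure_zero ?_ μ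
  intro s hs t ht
  simp only [not_not, mem_ofPred_eq] at hs ht
  exact Subtype.ext (hs.trans ht.symm)

theorem real_piece (x y : ℝ) : μ.real (piece x y) = evalQuery μ x y := by
  refine measureReal_congr ?_
  filter_upwards [ae_coe_ne μ y] with t ht
  have hty : (t : ℝ) < y ↔ (t : ℝ) ≤ y := ⟨le_of_lt, fun h => lt_of_le_of_ne h ht⟩
  have : t ∈ piece x y ↔ t ∈ {t : unitInterval | x ≤ (t : ℝ) ∧ (t : ℝ) ≤ y} := by
    simp only [piece, mem_ofPred_eq, hty]
    refine ⟨?_, Or.inl⟩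
    rintro (h | ⟨_, h1, h2⟩)
    · exact h
    · exact absurd (h2.trans h1.symm) ht
  exact propext this

theorem evalQuery_self (x : ℝ) : evalQuery μ x x = 0 := by
  have h : {t : unitInterval | x ≤ (t : ℝ) ∧ (t : ℝ) ≤ x}.Subsingleton := fun s hs t ht =>
    Subtype.ext ((le_antisymm hs.2 hs.1).trans (le_antisymm ht.2 ht.1).symm)
  simp [evalQuery, Measure.real, h.measure_zero μ]

theorem evalQuery_eq_integral {x y : ℝ} (hxy : x ≤ y) :
    evalQuery μ x y = ∫ _ in x..y, (1 : ℝ) ∂(μ.map ((↑) : unitInterval → ℝ)) := by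
  rw [intervalIntegral.integral_of_le hxy]
  simp only [integral_const, smul_eq_mul, mul_one, measureReal_restrict_apply_univ]
  rw [map_measureReal_apply measurable_subtype_coe measurableSet_Ioc]
  refine measureReal_congr ?_
  filter_upwards [ae_coe_ne μ x] with t ht
  exact propext ⟨fun h => ⟨lt_of_le_of_ne h.1 (Ne.symm ht), h.2⟩, fun h => ⟨h.1.le, h.2⟩⟩

instance nullSingletonClass_map_coe : NullSingletonClass (μ.map ((↑) : unitInterval → ℝ)) where
  measure_singleton y := by
    rw [Measure.map_apply measurable_subtype_coe (measurableSet_singleton y)]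
    simpa [ae_iff, Set.preimage] using ae_coe_ne μ y

variable [IsFiniteMeasure μ]

theorem evalQuery_add {x y z : ℝ} (hxy : x ≤ y) (hyz : y ≤ z) :
    evalQuery μ x y + evalQuery μ y z = evalQuery μ x z := by
  rw [evalQuery_eq_integral μ hxy, evalQuery_eq_integral μ hyz,
    evalQuery_eq_integral μ (hxy.trans hyz)]
  exact intervalIntegral.integral_add_adjacent_intervals
    intervalIntegrable_const intervalIntegrable_const

theorem continuousOn_evalQuery (x : ℝ) : ContinuousOn (evalQuery μ x) (Ici x) := by
  have h : Continuous fun y => ∫ _ in x..y, (1 : ℝ) ∂(μ.map ((↑) : unitInterval → ℝ)) :=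
    intervalIntegral.continuous_primitive (fun _ _ => intervalIntegrable_const) x
  exact h.continuousOn.congr fun y hy => evalQuery_eq_integral μ hy

/-- A mark query cuts off a piece of exactly the required value. -/
theorem evalQuery_markQuery {x a : ℝ} (hx : 0 ≤ x) (hx' : x ≤ 1) (ha : 0 ≤ a)
    (ha' : a ≤ evalQuery μ x 1) : evalQuery μ x (markQuery μ x a) = a := by
  set y := markQuery μ x a with hy
  have hxy : x ≤ y := le_markQuery μ hx'
  have hcont := continuousOn_evalQuery μ x
  have hmono : ∀ {u v : ℝ}, x ≤ u → u ≤ v → evalQuery μ x u ≤ evalQuery μ x v := by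
    intro u v hu huv
    rw [← evalQuery_add μ hu huv]
    linarith [evalQuery_nonneg μ u v]
  obtain ⟨z, hz, hza⟩ := intermediate_value_Icc hx' (hcont.mono Icc_subset_Ici_self)
    (show a ∈ Icc (evalQuery μ x x) (evalQuery μ x 1) from
      ⟨by rw [evalQuery_self]; exact ha, ha'⟩)
  apply le_antisymm
  · rw [← hza]
    exact hmono hxy (markQuery_le μ hx hz.1 hz.2 hza.ge)
  · -- the candidates for the mark form a closed set
    set S : Set ℝ := Icc x 1 ∩ evalQuery μ x ⁻¹' Ici a with hS
    have hclosed : IsClosed S :=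
      (hcont.mono Icc_subset_Ici_self).preimage_isClosed_of_isClosed isClosed_Icc isClosed_Ici
    have hSeq : {y : ℝ | 0 ≤ y ∧ y ≤ 1 ∧ x ≤ y ∧ a ≤ evalQuery μ x y} ∪ {1} = S := by
      ext w
      constructor
      · rintro (h | rfl)
        · exact ⟨⟨h.2.2.1, h.2.1⟩, h.2.2.2⟩
        · exact ⟨⟨hx', le_rfl⟩, ha'⟩
      · rintro ⟨⟨h1, h2⟩, h3⟩
        exact Or.inl ⟨hx.trans h1, h2, h1, h3⟩
    have : y ∈ S := by
      rw [hy, markQuery, hSeq]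
      exact hclosed.csInf_mem ⟨1, ⟨hx', le_rfl⟩, ha'⟩ ⟨x, fun w hw => hw.1.1⟩
    exact this.2

end Queries

/-! ### Contiguous lists of pieces -/

/-- `Chain n x G y`: the pieces in the list `G` are handed over to agents below `n` and lie next to
one another, from `x` to `y`. -/
def Chain (n : ℕ) (x : ℝ) : List (ℕ × ℝ × ℝ) → ℝ → Prop
  | [], y => x = y
  | g :: G, y => g.1 < n ∧ g.2.1 = x ∧ x ≤ g.2.2 ∧ Chain n g.2.2 G y

/-- The value, for the valuation `μ`, of the pieces in the list `G` that go to agent `i`. -/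
def worth (μ : Measure unitInterval) (i : ℕ) (G : List (ℕ × ℝ × ℝ)) : ℝ :=
  (G.map fun g => if g.1 = i then evalQuery μ g.2.1 g.2.2 else 0).sum

/-- The union of the pieces in the list `G` that go to agent `i`. -/
def shareOf (G : List (ℕ × ℝ × ℝ)) (i : ℕ) : Set unitInterval :=
  {p | ∃ x y : ℝ, (i, x, y) ∈ G ∧ p ∈ piece x y}

@[simp] theorem worth_append (μ : Measure unitInterval) (i : ℕ) (G H : List (ℕ × ℝ × ℝ)) :
    worth μ i (G ++ H) = worth μ i G + worth μ i H := by
  simp [worth]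

@[simp] theorem worth_singleton (μ : Measure unitInterval) (i j : ℕ) (x y : ℝ) :
    worth μ i [(j, x, y)] = if j = i then evalQuery μ x y else 0 := by
  simp [worth]

@[simp] theorem worth_nil (μ : Measure unitInterval) (i : ℕ) : worth μ i [] = 0 := by
  simp [worth]

variable {n : ℕ}

theorem Chain.le {x y : ℝ} {G : List (ℕ × ℝ × ℝ)} (h : Chain n x G y) : x ≤ y := by
  induction G generalizing x with
  | nil => exact le_of_eq h
  | cons g G ih => exact h.2.2.1.trans (ih h.2.2.2)

theorem Chain.append {x y z : ℝ} {G H : List (ℕ × ℝ × ℝ)} (h : Chain n x G y)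
    (h' : Chain n y H z) : Chain n x (G ++ H) z := by
  induction G generalizing x with
  | nil => rw [show x = y from h]; exact h'
  | cons g G ih => exact ⟨h.1, h.2.1, h.2.2.1, ih h.2.2.2⟩

theorem Chain.singleton {x y : ℝ} {i : ℕ} (hi : i < n) (hxy : x ≤ y) :
    Chain n x [(i, x, y)] y :=
  ⟨hi, rfl, hxy, rfl⟩

theorem piece_union {x y z : ℝ} (hxy : x ≤ y) (hyz : y ≤ z) (hz : z ≤ 1) :
    piece x y ∪ piece y z = piece x z := by
  ext t
  have ht := t.2.2
  simp only [piece, mem_union, mem_ofPred_eq]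
  constructor
  · rintro ((h | h) | (h | h))
    · exact Or.inl ⟨h.1, by linarith⟩
    · exact Or.inr ⟨by linarith, by linarith, h.2.2⟩
    · exact Or.inl ⟨by linarith, h.2⟩
    · exact Or.inr ⟨by linarith, h.2⟩
  · rintro (h | h)
    · rcases lt_or_ge (t : ℝ) y with hy | hy
      · exact Or.inl (Or.inl ⟨h.1, hy⟩)
      · exact Or.inr (Or.inl ⟨hy, h.2⟩)
    · rcases hyz.lt_or_eq with hy | hy
      · exact Or.inr (Or.inr ⟨hy, h.2⟩)
      · exact Or.inl (Or.inr ⟨by linarith, by linarith, h.2.2⟩)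

theorem piece_disjoint {x y z : ℝ} (hz : z ≤ 1) :
    Disjoint (piece x y) (piece y z) := by
  rw [Set.disjoint_left]
  rintro t (h | h) (h' | h')
  · linarith [h.2, h'.1]
  · linarith [h.2, h'.2.2]
  · linarith [h'.2]
  · linarith [h'.1]

theorem measurableSet_piece (x y : ℝ) : MeasurableSet (piece x y) := by
  unfold piece
  refine MeasurableSet.union ?_ ?_
  · exact (measurableSet_le measurable_const measurable_subtype_coe).inter
      (measurableSet_lt measurable_subtype_coe measurable_const)
  · refine MeasurableSet.inter (.const _) (MeasurableSet.inter (.const _) ?_)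
    exact measurableSet_eq_fun measurable_subtype_coe measurable_const

theorem shareOf_cons (g : ℕ × ℝ × ℝ) (G : List (ℕ × ℝ × ℝ)) (i : ℕ) :
    shareOf (g :: G) i = (if g.1 = i then piece g.2.1 g.2.2 else ∅) ∪ shareOf G i := by
  obtain ⟨j, u, v⟩ := g
  ext p
  simp only [shareOf, mem_ofPred_eq, List.mem_cons, mem_union, Prod.mk.injEq]
  constructor
  · rintro ⟨x, y, ⟨rfl, rfl, rfl⟩ | h, hp⟩
    · exact Or.inl (by simpa using hp)
    · exact Or.inr ⟨x, y, h, hp⟩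
  · rintro (h | ⟨x, y, h, hp⟩)
    · split_ifs at h with hji
      · exact ⟨u, v, Or.inl ⟨hji.symm, rfl, rfl⟩, h⟩
      · exact absurd h (notMem_empty p)
    · exact ⟨x, y, Or.inr h, hp⟩

theorem measurableSet_shareOf (G : List (ℕ × ℝ × ℝ)) (i : ℕ) : MeasurableSet (shareOf G i) := by
  induction G with
  | nil => simp [shareOf]
  | cons g G ih =>
    rw [shareOf_cons]
    refine MeasurableSet.union ?_ ih
    split_ifs
    · exact measurableSet_piece _ _
    · exact .empty

theorem Chain.shareOf_subset {x y : ℝ} {G : List (ℕ × ℝ × ℝ)} (h : Chain n x G y) (hy : y ≤ 1)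
    (i : ℕ) : shareOf G i ⊆ piece x y := by
  induction G generalizing x with
  | nil => simp [shareOf]
  | cons g G ih =>
    obtain ⟨-, rfl, hle, hG⟩ := h
    rw [shareOf_cons, ← piece_union hle hG.le hy]
    refine union_subset_union ?_ (ih hG)
    split_ifs
    · exact le_rfl
    · exact empty_subset _

theorem Chain.disjoint_shareOf {x y : ℝ} {G : List (ℕ × ℝ × ℝ)} (h : Chain n x G y) (hy : y ≤ 1)
    {i j : ℕ} (hij : i ≠ j) : Disjoint (shareOf G i) (shareOf G j) := by
  induction G generalizing x with
  | nil => simp [shareOf]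
  | cons g G ih =>
    obtain ⟨-, rfl, hle, hG⟩ := h
    have hd : ∀ k l, Disjoint (if g.1 = k then piece g.2.1 g.2.2 else ∅) (shareOf G l) := by
      intro k l
      split_ifs
      · exact (piece_disjoint hy).mono_right (hG.shareOf_subset hy l)
      · exact empty_disjoint _
    rw [shareOf_cons, shareOf_cons, disjoint_union_left, disjoint_union_right,
      disjoint_union_right]
    refine ⟨⟨?_, hd i j⟩, (hd j i).symm, ih hG⟩
    split_ifs with h1 h2
    · exact absurd (h1.symm.trans h2) hij
    all_goals simp

theorem Chain.piece_subset {x y : ℝ} {G : List (ℕ × ℝ × ℝ)} (h : Chain n x G y) (hy : y ≤ 1) :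
    piece x y ⊆ ⋃ i : Fin n, shareOf G i := by
  induction G generalizing x with
  | nil =>
    obtain rfl : x = y := h
    rintro t (ht | ht)
    · linarith [ht.1, ht.2]
    · exact absurd ht.1 (lt_irrefl _)
  | cons g G ih =>
    obtain ⟨hg, rfl, hle, hG⟩ := h
    rw [← piece_union hle hG.le hy]
    refine union_subset ?_ ((ih hG).trans (iUnion_mono fun i => ?_))
    · refine subset_iUnion_of_subset ⟨g.1, hg⟩ ?_
      rw [shareOf_cons]
      simp
    · rw [shareOf_cons]; exact subset_union_right

theorem Chain.real_shareOf {x y : ℝ} {G : List (ℕ × ℝ × ℝ)} (h : Chain n x G y) (hy : y ≤ 1)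
    (μ : Measure unitInterval) [NullSingletonClass μ] [IsFiniteMeasure μ] (i : ℕ) :
    μ.real (shareOf G i) = worth μ i G := by
  induction G generalizing x with
  | nil => simp [shareOf]
  | cons g G ih =>
    obtain ⟨-, rfl, hle, hG⟩ := h
    have hd : Disjoint (if g.1 = i then piece g.2.1 g.2.2 else ∅) (shareOf G i) := by
      split_ifs
      · exact (piece_disjoint hy).mono_right (hG.shareOf_subset hy i)
      · exact empty_disjoint _
    rw [shareOf_cons, measureReal_union hd (measurableSet_shareOf G i), ih hG]
    simp only [worth, List.map_cons, List.sum_cons]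
    congr 1
    split_ifs
    · exact real_piece μ _ _
    · simp

theorem piece_zero_one : piece 0 1 = univ := by
  refine eq_univ_of_forall fun t => ?_
  rcases t.2.2.lt_or_eq with h | h
  · exact Or.inl ⟨t.2.1, h⟩
  · exact Or.inr ⟨zero_lt_one, rfl, h⟩

end CakeCutting

namespace CakeCutting

/-! ### Marks that divide an interval into equal parts -/

/-- The right end of the first `j` of `m` parts of `[a, b]` that have the same value for `μ`. -/
def cutPt (μ : Measure unitInterval) (a b : ℝ) (m j : ℕ) : ℝ :=
  markQuery μ a (j * evalQuery μ a b / m)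

section CutPt

variable (μ : Measure unitInterval) {a b : ℝ} {m j : ℕ}

theorem cutPt_zero (ha : 0 ≤ a) (ha' : a ≤ 1) : cutPt μ a b m 0 = a := by
  simp [cutPt, markQuery_zero μ ha ha']

theorem le_cutPt (ha : a ≤ 1) : a ≤ cutPt μ a b m j := le_markQuery μ ha

theorem cutPt_mono {l : ℕ} (h : j ≤ l) : cutPt μ a b m j ≤ cutPt μ a b m l := by
  have := evalQuery_nonneg μ a b
  refine markQuery_mono μ a ?_
  gcongr

theorem share_le (hj : j ≤ m) : (j * evalQuery μ a b / m : ℝ) ≤ evalQuery μ a b := by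
  have := evalQuery_nonneg μ a b
  have hjm : (j : ℝ) ≤ m := by exact_mod_cast hj
  exact div_le_of_le_mul₀ (by positivity) this (by nlinarith)

theorem cutPt_le (ha : 0 ≤ a) (hab : a ≤ b) (hb : b ≤ 1) (hj : j ≤ m) : cutPt μ a b m j ≤ b :=
  markQuery_le μ ha hab hb (share_le μ hj)

variable [NullSingletonClass μ] [IsFiniteMeasure μ]

theorem evalQuery_cutPt (ha : 0 ≤ a) (hab : a ≤ b) (hb : b ≤ 1) (hj : j ≤ m) :
    evalQuery μ a (cutPt μ a b m j) = j * evalQuery μ a b / m := by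
  have := evalQuery_nonneg μ a b
  refine evalQuery_markQuery μ ha (hab.trans hb) (by positivity) ((share_le μ hj).trans ?_)
  rw [← evalQuery_add μ hab hb]
  linarith [evalQuery_nonneg μ b 1]

theorem evalQuery_cutPt_succ (ha : 0 ≤ a) (hab : a ≤ b) (hb : b ≤ 1) (hj : j + 1 ≤ m) :
    evalQuery μ (cutPt μ a b m j) (cutPt μ a b m (j + 1)) = evalQuery μ a b / m := by
  have h := evalQuery_add μ (le_cutPt μ (b := b) (m := m) (j := j) (hab.trans hb))
    (cutPt_mono μ (Nat.le_succ j))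
  rw [evalQuery_cutPt μ ha hab hb hj, evalQuery_cutPt μ ha hab hb (Nat.le_of_succ_le hj)] at h
  push_cast at h
  linear_combination h

theorem evalQuery_cutPt_last (ha : 0 ≤ a) (hab : a ≤ b) (hb : b ≤ 1) (hj : j + 1 = m) :
    evalQuery μ (cutPt μ a b m j) b = evalQuery μ a b / m := by
  have h := evalQuery_add μ (le_cutPt μ (b := b) (m := m) (j := j) (hab.trans hb))
    (cutPt_le μ ha hab hb (by omega : j ≤ m))
  rw [evalQuery_cutPt μ ha hab hb (by omega : j ≤ m)] at h
  have hm : (m : ℝ) ≠ 0 := by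
    rw [← hj]; positivity
  have hm' : (m : ℝ) = j + 1 := by rw [← hj]; push_cast; rfl
  field_simp at h ⊢
  rw [hm'] at h ⊢
  linear_combination h

end CutPt

/-! ### Agents that cannot be distinguished by equal cuts -/

open Classical in
/-- The elements of `F` at which `f` is minimal on `F`. -/
def leastBy {ι : Type*} (f : ι → ℝ) (F : Finset ι) : Finset ι :=
  F.filter fun i => ∀ j ∈ F, f i ≤ f j

theorem mem_leastBy {ι : Type*} {f : ι → ℝ} {F : Finset ι} {i : ι} :
    i ∈ leastBy f F ↔ i ∈ F ∧ ∀ j ∈ F, f i ≤ f j := by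
  simp [leastBy]

theorem leastBy_subset {ι : Type*} (f : ι → ℝ) (F : Finset ι) : leastBy f F ⊆ F :=
  fun _ hi => (mem_leastBy.1 hi).1

theorem leastBy_nonempty {ι : Type*} (f : ι → ℝ) {F : Finset ι} (hF : F.Nonempty) :
    (leastBy f F).Nonempty := by
  obtain ⟨i, hi, h⟩ := F.exists_min_image f hF
  exact ⟨i, mem_leastBy.2 ⟨hi, h⟩⟩

variable {n : ℕ} (V : Fin n → Measure unitInterval)

/-- The agents in `F` whose sequence of the first `J` of the cuts that divide `[a, b]` into `m`
equal parts is lexicographically least. -/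
def refineSet (a b : ℝ) (m : ℕ) : ℕ → Finset (Fin n) → Finset (Fin n)
  | 0, F => F
  | j + 1, F => leastBy (fun i => cutPt (V i) a b m (j + 1)) (refineSet a b m j F)

theorem refineSet_subset (a b : ℝ) (m J : ℕ) (F : Finset (Fin n)) :
    refineSet V a b m J F ⊆ F := by
  induction J with
  | zero => exact subset_rfl
  | succ J ih => exact (leastBy_subset _ _).trans ih

theorem refineSet_nonempty (a b : ℝ) (m J : ℕ) {F : Finset (Fin n)} (hF : F.Nonempty) :
    (refineSet V a b m J F).Nonempty := by
  induction J with
  | zero => exact hF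
  | succ J ih => exact leastBy_nonempty _ ih

theorem cutPt_eq_of_mem_refineSet {a b : ℝ} {m J : ℕ} {F : Finset (Fin n)} {i i' : Fin n}
    (hi : i ∈ refineSet V a b m J F) (hi' : i' ∈ refineSet V a b m J F) {j : ℕ} (hj : j < J) :
    cutPt (V i) a b m (j + 1) = cutPt (V i') a b m (j + 1) := by
  induction J with
  | zero => omega
  | succ J ih =>
    obtain ⟨h1, h2⟩ := mem_leastBy.1 hi
    obtain ⟨h1', h2'⟩ := mem_leastBy.1 hi'
    rcases Nat.lt_succ_iff_lt_or_eq.1 hj with h | rfl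
    · exact ih h1 h1' h
    · exact le_antisymm (h2 i' h1') (h2' i h1)

/-- Starting from all agents, `[a, b]` is repeatedly cut into as many equal parts as agents are
left, and only the agents with the lexicographically least cuts are kept. -/
def coalition (a b : ℝ) : ℕ → Finset (Fin n)
  | 0 => Finset.univ
  | r + 1 => refineSet V a b (coalition a b r).card n (coalition a b r)

theorem coalition_nonempty [NeZero n] (a b : ℝ) (r : ℕ) : (coalition V a b r).Nonempty := by
  induction r with
  | zero => exact Finset.univ_nonempty
  | succ r ih => exact refineSet_nonempty V _ _ _ _ ih

/-- After `n` rounds the coalition no longer shrinks. -/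
theorem coalition_stable (a b : ℝ) : coalition V a b (n + 1) = coalition V a b n := by
  have key : ∀ r, coalition V a b (r + 1) = coalition V a b r ∨
      (coalition V a b (r + 1)).card + (r + 1) ≤ n := by
    intro r
    have hlt : ∀ r, coalition V a b (r + 1) ≠ coalition V a b r →
        (coalition V a b (r + 1)).card < (coalition V a b r).card := fun r h =>
      Finset.card_lt_card ((refineSet_subset V _ _ _ _ _).ssubset_of_ne h)
    induction r with
    | zero =>
      by_cases h : coalition V a b (0 + 1) = coalition V a b 0
      · exact Or.inl h
      · have := hlt 0 h
        have h0 : (coalition V a b 0).card = n := by simp [coalition]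
        omega
    | succ r ih =>
      by_cases h : coalition V a b (r + 1 + 1) = coalition V a b (r + 1)
      · exact Or.inl h
      · rcases ih with ih | ih
        · refine absurd ?_ h
          conv_lhs => rw [coalition, ih]
          rfl
        · have := hlt (r + 1) h
          omega
  rcases key n with h | h
  · exact h
  · omega

/-- All members of the final coalition cut `[a, b]` into equal parts at the same points. -/
theorem cutPt_eq_of_mem_coalition {a b : ℝ} {i i' : Fin n} (hi : i ∈ coalition V a b n)
    (hi' : i' ∈ coalition V a b n) {j : ℕ} (hj : j < n) :
    cutPt (V i) a b (coalition V a b n).card (j + 1) =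
      cutPt (V i') a b (coalition V a b n).card (j + 1) := by
  rw [← coalition_stable V a b] at hi hi'
  exact cutPt_eq_of_mem_refineSet V hi hi' hj

/-- The value that an agent receives when `[a, b]` is divided equally among the final coalition. -/
def bonus (a b : ℝ) (i : Fin n) : ℝ :=
  if i ∈ coalition V a b n then evalQuery (V i) a b / (coalition V a b n).card else 0

theorem bonus_nonneg (a b : ℝ) (i : Fin n) : 0 ≤ bonus V a b i := by
  unfold bonus
  have := evalQuery_nonneg (V i) a b
  split_ifs <;> positivity

section Equivariance

variable (σ : Equiv.Perm (Fin n))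

theorem mem_leastBy_perm (f : Fin n → ℝ) {F F' : Finset (Fin n)}
    (h : ∀ j, j ∈ F' ↔ σ j ∈ F) (j : Fin n) :
    j ∈ leastBy (fun i => f (σ i)) F' ↔ σ j ∈ leastBy f F := by
  rw [mem_leastBy, mem_leastBy, h, ← σ.forall_congr_right (q := fun i => i ∈ F → f (σ j) ≤ f i)]
  simp only [h]

theorem mem_refineSet_perm (a b : ℝ) (m J : ℕ) {F F' : Finset (Fin n)}
    (h : ∀ j, j ∈ F' ↔ σ j ∈ F) (j : Fin n) :
    j ∈ refineSet (fun i => V (σ i)) a b m J F' ↔ σ j ∈ refineSet V a b m J F := by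
  induction J generalizing j with
  | zero => exact h j
  | succ J ih => exact mem_leastBy_perm σ (fun i => cutPt (V i) a b m (J + 1)) ih j

theorem card_eq_of_perm {F F' : Finset (Fin n)} (h : ∀ j, j ∈ F' ↔ σ j ∈ F) :
    F'.card = F.card :=
  Finset.card_equiv σ h

theorem mem_coalition_perm (a b : ℝ) (r : ℕ) (j : Fin n) :
    j ∈ coalition (fun i => V (σ i)) a b r ↔ σ j ∈ coalition V a b r := by
  induction r generalizing j with
  | zero => simp [coalition]
  | succ r ih =>
    rw [coalition, coalition, card_eq_of_perm σ ih]
    exact mem_refineSet_perm V σ a b _ n ih j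

theorem bonus_perm (a b : ℝ) (j : Fin n) :
    bonus (fun i => V (σ i)) a b j = bonus V a b (σ j) := by
  have h := mem_coalition_perm V σ a b n
  simp only [bonus, h, card_eq_of_perm σ h]

end Equivariance

/-! ### The order in which the agents are served -/

/-- The agents of `R` that may be served in round `k`: their cut number `k + 1`, when the cake is
divided into `n` equal parts, is leftmost, and ties are broken by comparing all cuts
lexicographically. The agents in this set have the same cuts. -/
def candidates (k : ℕ) (R : Finset (Fin n)) : Finset (Fin n) :=
  refineSet V 0 1 n n (leastBy (fun i => cutPt (V i) 0 1 n (k + 1)) R)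

/-- `PickRun V k R x e`: it is possible that after `k` rounds the agents in `R` are still to be
served, the cake is allocated up to `x`, and `e i` is the value of agent `i` for what it has
received from the gaps between the regular pieces. -/
inductive PickRun : ℕ → Finset (Fin n) → ℝ → (Fin n → ℝ) → Prop
  | zero : PickRun 0 Finset.univ 0 fun _ => 0
  | step {k : ℕ} {R : Finset (Fin n)} {x : ℝ} {e : Fin n → ℝ} {p : Fin n} :
    PickRun k R x e → p ∈ candidates V k R →
    PickRun (k + 1) (R.erase p) (cutPt (V p) 0 1 n (k + 1))
      fun i => e i + bonus V x (cutPt (V p) 0 1 n k) i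

theorem candidates_subset (k : ℕ) (R : Finset (Fin n)) :
    candidates V k R ⊆ leastBy (fun i => cutPt (V i) 0 1 n (k + 1)) R :=
  refineSet_subset V _ _ _ _ _

theorem candidates_nonempty (k : ℕ) {R : Finset (Fin n)} (hR : R.Nonempty) :
    (candidates V k R).Nonempty :=
  refineSet_nonempty V _ _ _ _ (leastBy_nonempty _ hR)

namespace PickRun

variable {V} {k : ℕ} {R : Finset (Fin n)} {x : ℝ} {e : Fin n → ℝ}

theorem card_add (h : PickRun V k R x e) : R.card + k = n := by
  induction h with
  | zero => simp
  | step h hp ih =>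
    have hpR := leastBy_subset _ _ (candidates_subset V _ _ hp)
    have := Finset.card_pos.2 ⟨_, hpR⟩
    rw [Finset.card_erase_of_mem hpR]
    omega

theorem mem_Icc (h : PickRun V k R x e) : x ∈ Icc (0 : ℝ) 1 := by
  cases h with
  | zero => simp
  | step h hp => exact ⟨le_cutPt _ zero_le_one, markQuery_le_one _ _ _⟩

theorem le_cutPt (h : PickRun V k R x e) {i : Fin n} (hi : i ∈ R) :
    x ≤ cutPt (V i) 0 1 n k := by
  cases h with
  | zero => exact CakeCutting.le_cutPt _ zero_le_one
  | step h hp =>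
    exact (mem_leastBy.1 (candidates_subset V _ _ hp)).2 i (Finset.mem_of_mem_erase hi)

theorem nonneg (h : PickRun V k R x e) (i : Fin n) : 0 ≤ e i := by
  induction h with
  | zero => exact le_rfl
  | step h hp ih => exact add_nonneg ih (bonus_nonneg V _ _ _)

end PickRun

/-- The cuts of agent `i` that divide the cake into `n` equal parts. -/
def profile (i : Fin n) : Fin n → ℝ := fun j => cutPt (V i) 0 1 n (j + 1)

section Multiset

variable {V} {W : Fin n → Measure unitInterval}

theorem map_leastBy {ι β : Type*} {g g' : ι → β} {F F' : Finset ι} (φ : β → ℝ)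
    (h : F.val.map g = F'.val.map g') :
    (leastBy (fun i => φ (g i)) F).val.map g = (leastBy (fun i => φ (g' i)) F').val.map g' := by
  classical
  have aux : ∀ (g : ι → β) (F : Finset ι), (leastBy (fun i => φ (g i)) F).val.map g =
      (F.val.map g).filter fun v => ∀ u ∈ F.val.map g, φ v ≤ φ u := by
    intro g F
    rw [Multiset.filter_map, leastBy, Finset.filter_val]
    congr 1
    refine Multiset.filter_congr fun i _ => ?_
    simp
  rw [aux, aux, h]

theorem map_refineSet {F F' : Finset (Fin n)}
    (h : F.val.map (profile V) = F'.val.map (profile W)) {J : ℕ} (hJ : J ≤ n) :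
    (refineSet V 0 1 n J F).val.map (profile V) =
      (refineSet W 0 1 n J F').val.map (profile W) := by
  induction J with
  | zero => exact h
  | succ J ih => exact map_leastBy (fun v => v ⟨J, hJ⟩) (ih (by omega))

/-- The cuts of the agent served in round `k` depend only on the multiset of the cuts of all
agents still to be served. -/
theorem profile_eq_of_mem_candidates {k : ℕ} (hk : k < n) {R R' : Finset (Fin n)}
    (h : R.val.map (profile V) = R'.val.map (profile W)) {p p' : Fin n}
    (hp : p ∈ candidates V k R) (hp' : p' ∈ candidates W k R') : profile V p = profile W p' := by
  have hmap : (candidates V k R).val.map (profile V) = (candidates W k R').val.map (profile W) :=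
    map_refineSet (map_leastBy (fun v : Fin n → ℝ => v ⟨k, hk⟩) h) le_rfl
  have : profile V p ∈ (candidates W k R').val.map (profile W) :=
    hmap ▸ Multiset.mem_map_of_mem _ hp
  obtain ⟨q, hq, hqp⟩ := Multiset.mem_map.1 this
  rw [← hqp]
  funext j
  exact cutPt_eq_of_mem_refineSet W hq hp' j.2

theorem cutPt_eq_of_profile_eq {p p' : Fin n} (h : profile V p = profile W p') {k : ℕ}
    (hk : k ≤ n) : cutPt (V p) 0 1 n k = cutPt (W p') 0 1 n k := by
  cases k with
  | zero => rw [cutPt_zero _ le_rfl zero_le_one, cutPt_zero _ le_rfl zero_le_one]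
  | succ k => exact congrFun h ⟨k, hk⟩

end Multiset

variable {V}

/-- Different runs, on the same agents in different orders, allocate the same gaps to the same
coalitions, although the regular pieces may go to different agents. -/
theorem PickRun.perm (σ : Equiv.Perm (Fin n)) {k : ℕ} {R R' : Finset (Fin n)} {x x' : ℝ}
    {e e' : Fin n → ℝ} (h : PickRun V k R x e) (h' : PickRun (fun i => V (σ i)) k R' x' e') :
    x' = x ∧ R'.val.map (profile fun i => V (σ i)) = R.val.map (profile V) ∧
      ∀ j, e' j = e (σ j) := by
  classical
  induction h generalizing R' x' e' with
  | zero =>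
    cases h'
    refine ⟨rfl, ?_, fun _ => rfl⟩
    conv_rhs => rw [← Finset.map_univ_equiv σ, Finset.map_val, Multiset.map_map]
    rfl
  | @step k R x e p h hp ih =>
    cases h' with
    | @step _ R' x' e' p' h' hp' =>
      obtain ⟨rfl, hR, he⟩ := ih h'
      have hk : k < n := by
        have := (PickRun.step h hp).card_add
        omega
      have hprof := profile_eq_of_mem_candidates hk hR hp' hp
      have hmem := leastBy_subset _ _ (candidates_subset V _ _ hp)
      have hmem' := leastBy_subset _ _ (candidates_subset _ _ _ hp')
      refine ⟨cutPt_eq_of_profile_eq hprof hk, ?_, fun j => ?_⟩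
      · rw [Finset.erase_val, Finset.erase_val, Multiset.map_erase_of_mem _ _ hmem,
          Multiset.map_erase_of_mem _ _ hmem', hR, hprof]
      · have hu : cutPt (V (σ p')) 0 1 n k = cutPt (V p) 0 1 n k :=
          cutPt_eq_of_profile_eq hprof hk.le
        change e' j + bonus (fun i => V (σ i)) _ _ j = _
        rw [he, hu, bonus_perm]

end CakeCutting

namespace CakeCutting

/-! ### Building blocks of the program

The arrays of the machine get names. Natural numbers: loop counters (`nRound`, `nPass`, `nCut`,
`nAgent`, `nOther`), the number of parts `nParts` of an equal division, the agent `nPick` that is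
served, the number `nDone` of parts handed over, and two arrays of flags that represent sets of
agents: `nFlag` for the agents under comparison and `nLeft` for those still to be served. Reals: the
ends `rLeft` and `rRight` of the interval to be divided, the
start `rFree` of the unallocated cake, and the auxiliary positions `rFrom`, `rTo`, `rNext`. -/

local notation "nRound" => (1 : ℕ)
local notation "nPass" => (2 : ℕ)
local notation "nCut" => (3 : ℕ)
local notation "nAgent" => (4 : ℕ)
local notation "nOther" => (5 : ℕ)
local notation "nParts" => (6 : ℕ)
local notation "nFlag" => (7 : ℕ)
local notation "nLeft" => (8 : ℕ)
local notation "nPick" => (9 : ℕ)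
local notation "nDone" => (10 : ℕ)
local notation "rLeft" => (0 : ℕ)
local notation "rRight" => (1 : ℕ)
local notation "rFree" => (2 : ℕ)
local notation "rFrom" => (3 : ℕ)
local notation "rTo" => (4 : ℕ)
local notation "rNext" => (5 : ℕ)

open Code

/-- The set of agents represented by an array of flags. -/
def flagSet (n : ℕ) (f : ℕ → ℕ → ℕ) : Finset (Fin n) := Finset.univ.filter fun i => 1 ≤ f i 0

/-- The expression `e + 1`. -/
abbrev NatExpr.succ (e : NatExpr) : NatExpr := .add e (.const 1)

/-- The cut number `e` of agent `i`, when the current interval is divided into `nParts` equal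
parts. -/
def cutExpr (i e : NatExpr) : RealExpr :=
  .mark i (.var rLeft)
    (.div (.mul (.ofNat e) (.eval i (.var rLeft) (.var rRight))) (.ofNat (.var nParts)))

/-- Whether agent `i` belongs to the current set of agents. -/
def flagged (i : NatExpr) : Test := .natLe (.const 1) (.cell nFlag i)

/-- Unflag agent `nAgent` if `nOther` is flagged and has its cut number `nCut + 1` further left. -/
def unflagDominated : Code :=
  .onlyIf
    (.and (flagged (.var nOther))
      (.not (.realLe (cutExpr (.var nAgent) (.succ (.var nCut)))
        (cutExpr (.var nOther) (.succ (.var nCut))))))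
    (.setNat nFlag (.var nAgent) (.const 0))

/-- Keep the agents whose cut number `nCut + 1` is leftmost. -/
def keepLeast : Code := .forAll nAgent (.forAll nOther unflagDominated)

/-- Keep the agents whose sequence of cuts is lexicographically least. -/
def refineCode : Code := .forAll nCut keepLeast

/-- Set `nParts` to the number of flagged agents. -/
def countFlags : Code :=
  .setNat nParts (.const 0) (.const 0) ;;
  .forAll nAgent (.onlyIf (flagged (.var nAgent))
    (.setNat nParts (.const 0) (.succ (.var nParts))))

/-- Flag the final coalition for the current interval, and count its members. -/
def formCoalition : Code :=
  .forAll nAgent (.setNat nFlag (.var nAgent) (.const 1)) ;;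
  .forAll nPass (countFlags ;; refineCode) ;;
  countFlags

/-- Hand over the next part to agent `nAgent`. The last part ends exactly at `rRight`, which may lie
to the right of the agent's last cut. -/
def handOver : Code :=
  .setReal rTo (cutExpr (.var nAgent) (.succ (.var nDone))) ;;
  .onlyIf (.natLe (.var nParts) (.succ (.var nDone))) (.setReal rTo (.var rRight)) ;;
  .give (.var nAgent) (.var rFrom) (.var rTo) ;;
  .setReal rFrom (.var rTo) ;;
  .setNat nDone (.const 0) (.succ (.var nDone))

/-- Hand over the current interval, in `nParts` equal parts, to the flagged agents. -/
def distribute : Code :=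
  .setNat nDone (.const 0) (.const 0) ;;
  .setReal rFrom (.var rLeft) ;;
  .forAll nAgent (.onlyIf (flagged (.var nAgent)) handOver)

/-- Set `nPick` to some flagged agent. -/
def pickFlagged : Code :=
  .forAll nAgent (.onlyIf (flagged (.var nAgent)) (.setNat nPick (.const 0) (.var nAgent)))

/-- Choose the agent to be served in the current round. -/
def select : Code :=
  .forAll nAgent (.setNat nFlag (.var nAgent) (.cell nLeft (.var nAgent))) ;;
  .setReal rLeft (.const 0) ;;
  .setReal rRight (.const 1) ;;
  .setNat nParts (.const 0) (.var 0) ;;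
  .setNat nCut (.const 0) (.var nRound) ;;
  keepLeast ;;
  refineCode ;;
  pickFlagged

/-- Divide the current interval equally among the final coalition. -/
def divideGap : Code := formCoalition ;; distribute

/-- Serve one agent, and divide the gap to the left of its piece. -/
def serve : Code :=
  select ;;
  .setReal rNext (cutExpr (.var nPick) (.succ (.var nRound))) ;;
  .setReal rRight (cutExpr (.var nPick) (.var nRound)) ;;
  .setReal rLeft (.var rFree) ;;
  divideGap ;;
  .give (.var nPick) (.var rRight) (.var rNext) ;;
  .setReal rFree (.var rNext) ;;
  .setNat nLeft (.var nPick) (.const 0)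

/-- The symmetric proportional cake cutting protocol. -/
def protocol : Code :=
  .forAll nAgent (.setNat nLeft (.var nAgent) (.const 1)) ;;
  .setReal rFree (.const 0) ;;
  .forAll nRound serve ;;
  .setReal rLeft (.var rFree) ;;
  .setReal rRight (.const 1) ;;
  divideGap

/-! ### What the building blocks compute -/

variable {n : ℕ} {V : Fin n → Measure unitInterval}

theorem mem_flagSet {f : ℕ → ℕ → ℕ} {i : Fin n} : i ∈ flagSet n f ↔ 1 ≤ f i 0 := by
  simp [flagSet]

theorem flagSet_setNat_zero (s : State) (a : ℕ) (i : Fin n) :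
    flagSet n ((s.setNat a i 0 0).nat a) = (flagSet n (s.nat a)).erase i := by
  ext j
  rw [mem_flagSet, Finset.mem_erase, mem_flagSet]
  by_cases h : j = i
  · simp [h]
  · simp [State.setNat, h, Fin.val_inj]

theorem holds_flagged {s : State} {e : NatExpr} {i : Fin n} (h : e.val s = i) :
    (flagged e).Holds V s ↔ i ∈ flagSet n (s.nat nFlag) := by
  simp [flagged, Test.Holds, NatExpr.val, h, mem_flagSet]

theorem val_cutExpr {s : State} {i e : NatExpr} {p : Fin n} (h : i.val s = p) :
    (cutExpr i e).val V s =
      cutPt (V p) (s.real rLeft 0 0) (s.real rRight 0 0) (s.nat nParts 0 0) (e.val s) := by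
  simp [cutExpr, RealExpr.val, NatExpr.val, h, cutPt]

/-- The invariant of `keepLeast`: `F` lies between `F₀` and its set of minimizers of `f`, and has
been checked for the pairs of agents that precede `(k, l)` lexicographically. -/
def Checked (f : Fin n → ℝ) (F₀ F : Finset (Fin n)) (k l : ℕ) : Prop :=
  leastBy f F₀ ⊆ F ∧ F ⊆ F₀ ∧
    ∀ i ∈ F, ∀ j ∈ F, ((i : ℕ) < k ∨ (i : ℕ) = k ∧ (j : ℕ) < l) → f i ≤ f j

theorem Checked.erase {f : Fin n → ℝ} {F₀ F : Finset (Fin n)} {k l : Fin n}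
    (h : Checked f F₀ F k l) (hl : l ∈ F) (hlt : f l < f k) :
    Checked f F₀ (F.erase k) k (l + 1) := by
  refine ⟨fun i hi => Finset.mem_erase.2 ⟨?_, h.1 hi⟩, (Finset.erase_subset _ _).trans h.2.1, ?_⟩
  · rintro rfl
    exact absurd ((mem_leastBy.1 hi).2 l (h.2.1 hl)) (not_le.2 hlt)
  · intro i hi j hj hij
    obtain ⟨hik, hi⟩ := Finset.mem_erase.1 hi
    have : (i : ℕ) ≠ k := fun h => hik (Fin.ext h)
    exact h.2.2 i hi j (Finset.mem_of_mem_erase hj) (Or.inl (by tauto))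

theorem Checked.keep {f : Fin n → ℝ} {F₀ F : Finset (Fin n)} {k l : Fin n}
    (h : Checked f F₀ F k l) (hl : ¬ (l ∈ F ∧ f l < f k)) : Checked f F₀ F k (l + 1) := by
  refine ⟨h.1, h.2.1, fun i hi j hj hij => ?_⟩
  by_cases hc : i = k ∧ j = l
  · obtain ⟨rfl, rfl⟩ := hc
    exact not_lt.1 fun hlt => hl ⟨hj, hlt⟩
  · rw [Fin.ext_iff, Fin.ext_iff] at hc
    exact h.2.2 i hi j hj (by omega)

theorem Checked.eq_leastBy {f : Fin n → ℝ} {F₀ F : Finset (Fin n)} (h : Checked f F₀ F n 0) :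
    F = leastBy f F₀ := by
  refine Finset.Subset.antisymm (fun i hi => ?_) h.1
  obtain ⟨j, hj⟩ := leastBy_nonempty f ⟨i, h.2.1 hi⟩
  exact mem_leastBy.2 ⟨h.2.1 hi, fun l hl =>
    (h.2.2 i hi j (h.1 hj) (Or.inl i.2)).trans ((mem_leastBy.1 hj).2 l hl)⟩

theorem flagSet_keepLeast (s : State) :
    flagSet n ((keepLeast.denote V s).nat nFlag) =
      leastBy (fun i => cutPt (V i) (s.real rLeft 0 0) (s.real rRight 0 0) (s.nat nParts 0 0)
        (s.nat nCut 0 0 + 1)) (flagSet n (s.nat nFlag)) := by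
  set f : Fin n → ℝ := fun i => cutPt (V i) (s.real rLeft 0 0) (s.real rRight 0 0)
    (s.nat nParts 0 0) (s.nat nCut 0 0 + 1) with hf
  set F₀ := flagSet n (s.nat nFlag) with hF₀
  set same : State → Prop := fun s' =>
    s'.real = s.real ∧ s'.nat nParts = s.nat nParts ∧ s'.nat nCut = s.nat nCut with hsame
  have := denote_forAll (V := V) nAgent (.forAll nOther unflagDominated) s
    (fun k s' => same s' ∧ Checked f F₀ (flagSet n (s'.nat nFlag)) k 0)
    (by
      refine ⟨by simp [hsame], ?_⟩
      simp only [State.setNat_nat_ne s (show nFlag ≠ nAgent by decide)]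
      exact ⟨leastBy_subset _ _, subset_rfl, fun i _ j _ h => by omega⟩)
    (by
      intro k hk s₁ hk₁ ⟨hs₁, hF₁⟩
      have := denote_forAll (V := V) nOther unflagDominated s₁
        (fun l s' => same s' ∧ s'.nat nAgent 0 0 = k ∧
          Checked f F₀ (flagSet n (s'.nat nFlag)) k l)
        (by simpa [hsame, hk₁] using ⟨hs₁, hF₁⟩)
        (by
          intro l hl s₂ hl₂ ⟨hs₂, hk₂, hF₂⟩
          have hval : ∀ (c : ℕ) (i : Fin n), s₂.nat c 0 0 = i →
              (cutExpr (.var c) (.succ (.var nCut))).val V s₂ = f i := by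
            intro c i hi
            rw [val_cutExpr (p := i) (by simpa [NatExpr.val] using hi), hs₂.1, hs₂.2.1]
            simp [NatExpr.val, hs₂.2.2, hf]
          have htest : (Test.and (flagged (.var nOther))
              (.not (.realLe (cutExpr (.var nAgent) (.succ (.var nCut)))
                (cutExpr (.var nOther) (.succ (.var nCut)))))).Holds V s₂ ↔
              (⟨l, hl⟩ : Fin n) ∈ flagSet n (s₂.nat nFlag) ∧ f ⟨l, hl⟩ < f ⟨k, hk⟩ := by
            rw [Test.Holds, holds_flagged (i := ⟨l, hl⟩) (by simpa [NatExpr.val] using hl₂),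
              Test.Holds, Test.Holds, hval nAgent ⟨k, hk⟩ hk₂, hval nOther ⟨l, hl⟩ hl₂, not_le]
          rw [unflagDominated, denote]
          split_ifs with h
          · rw [htest] at h
            refine ⟨by simpa [hsame, denote] using hs₂, by simpa [denote] using hk₂, ?_⟩
            rw [State.setNat_nat_ne _ (by decide)]
            simp only [denote, NatExpr.val, hk₂]
            rw [flagSet_setNat_zero s₂ nFlag ⟨k, hk⟩]
            exact Checked.erase (k := ⟨k, hk⟩) (l := ⟨l, hl⟩) hF₂ h.1 h.2
          · rw [htest] at h
            refine ⟨by simpa [hsame] using hs₂, by simpa using hk₂, ?_⟩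
            rw [State.setNat_nat_ne _ (by decide)]
            exact Checked.keep (k := ⟨k, hk⟩) (l := ⟨l, hl⟩) hF₂ h)
      refine ⟨by simpa [hsame] using this.1, ?_⟩
      rw [State.setNat_nat_ne _ (by decide)]
      obtain ⟨-, -, h1, h2, h3⟩ := this
      refine ⟨h1, h2, fun i hi j hj h => h3 i hi j hj ?_⟩
      have := j.2
      omega)
  exact this.2.eq_leastBy

theorem flagSet_refineCode (s : State) :
    flagSet n ((refineCode.denote V s).nat nFlag) =
      refineSet V (s.real rLeft 0 0) (s.real rRight 0 0) (s.nat nParts 0 0) n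
        (flagSet n (s.nat nFlag)) := by
  have := denote_forAll (V := V) nCut keepLeast s
    (fun k s' => s'.real rLeft = s.real rLeft ∧ s'.real rRight = s.real rRight ∧
      s'.nat nParts = s.nat nParts ∧ flagSet n (s'.nat nFlag) =
      refineSet V (s.real rLeft 0 0) (s.real rRight 0 0) (s.nat nParts 0 0) k
        (flagSet n (s.nat nFlag)))
    (by simp [refineSet])
    (by
      intro k hk s' hks ⟨h1, h2, h3, h4⟩
      refine ⟨by simpa [denote_real (P := keepLeast) (a := rLeft) rfl] using h1,
        by simpa [denote_real (P := keepLeast) (a := rRight) rfl] using h2,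
        by simpa [denote_nat (P := keepLeast) (a := nParts) rfl] using h3, ?_⟩
      rw [State.setNat_nat_ne _ (by decide), flagSet_keepLeast, h1, h2, h3, h4, hks]
      rfl)
  exact this.2.2.2

theorem card_filter_lt_succ (F : Finset (Fin n)) {k : ℕ} (hk : k < n) :
    (F.filter fun i : Fin n => (i : ℕ) < k + 1).card =
      (F.filter fun i : Fin n => (i : ℕ) < k).card + if ⟨k, hk⟩ ∈ F then 1 else 0 := by
  have : (F.filter fun i : Fin n => (i : ℕ) < k + 1) = if ⟨k, hk⟩ ∈ F then
      insert ⟨k, hk⟩ (F.filter fun i : Fin n => (i : ℕ) < k) else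
      F.filter fun i : Fin n => (i : ℕ) < k := by
    split_ifs with h <;> ext i <;> simp only [Finset.mem_filter, Finset.mem_insert, Fin.ext_iff]
    · constructor
      · rintro ⟨h1, h2⟩
        by_cases hi : (i : ℕ) = k
        · exact Or.inl hi
        · exact Or.inr ⟨h1, by omega⟩
      · rintro (hi | ⟨h1, h2⟩)
        · exact ⟨by rwa [show i = ⟨k, hk⟩ from Fin.ext hi], by omega⟩
        · exact ⟨h1, by omega⟩
    · refine and_congr_right fun h1 => ?_
      have : (i : ℕ) ≠ k := by
        rintro rfl; exact h h1
      omega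
  rw [this]
  split_ifs
  · rw [Finset.card_insert_of_notMem (by simp)]
  · rfl

theorem filter_lt_self (F : Finset (Fin n)) : (F.filter fun i : Fin n => (i : ℕ) < n) = F :=
  Finset.filter_true_of_mem fun i _ => i.2

theorem nParts_countFlags (s : State) :
    (countFlags.denote V s).nat nParts 0 0 = (flagSet n (s.nat nFlag)).card := by
  have := denote_forAll (V := V) nAgent (.onlyIf (flagged (.var nAgent))
    (.setNat nParts (.const 0) (.succ (.var nParts)))) (s.setNat nParts 0 0 0)
    (fun k s' => s'.nat nFlag = s.nat nFlag ∧
      s'.nat nParts 0 0 = ((flagSet n (s.nat nFlag)).filter fun i : Fin n => (i : ℕ) < k).card)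
    (by simp)
    (by
      intro k hk s' hks ⟨h1, h2⟩
      rw [card_filter_lt_succ _ hk, denote,
        holds_flagged (i := ⟨k, hk⟩) (by simpa [NatExpr.val] using hks), h1]
      split_ifs
      · simp [denote, NatExpr.val, h1, h2]
      · simp [h1, h2])
  rw [filter_lt_self] at this
  exact this.2

theorem flagSet_forAll_one (a : ℕ) (ha : a ≠ nAgent) (s : State) :
    flagSet n (((Code.forAll nAgent (.setNat a (.var nAgent) (.const 1))).denote V s).nat a) =
      Finset.univ := by
  have := denote_forAll (V := V) nAgent (.setNat a (.var nAgent) (.const 1)) s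
    (fun k s' => ∀ i < k, s'.nat a i 0 = 1)
    (by simp)
    (by
      intro k hk s' hks h i hi
      rw [State.setNat_nat_ne _ ha]
      by_cases hik : i = k
      · simp [denote, NatExpr.val, hks, hik]
      · simpa [denote, NatExpr.val, hks, State.setNat, hik] using h i (by omega))
  ext i
  simp [mem_flagSet, this i i.2]

theorem flagSet_forAll_copy (s : State) :
    flagSet n (((Code.forAll nAgent
      (.setNat nFlag (.var nAgent) (.cell nLeft (.var nAgent)))).denote V s).nat nFlag) =
      flagSet n (s.nat nLeft) := by
  have := denote_forAll (V := V) nAgent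
    (.setNat nFlag (.var nAgent) (.cell nLeft (.var nAgent))) s
    (fun k s' => s'.nat nLeft = s.nat nLeft ∧ ∀ i < k, s'.nat nFlag i 0 = s.nat nLeft i 0)
    (by simp)
    (by
      intro k hk s' hks ⟨h1, h2⟩
      refine ⟨by simpa [denote] using h1, fun i hi => ?_⟩
      rw [State.setNat_nat_ne _ (by decide)]
      by_cases hik : i = k
      · simp [denote, NatExpr.val, hks, hik, h1]
      · simpa [denote, NatExpr.val, hks, State.setNat, hik] using h2 i (by omega))
  ext i
  rw [mem_flagSet, mem_flagSet, this.2 i i.2]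

theorem flagSet_formCoalition (s : State) :
    flagSet n ((formCoalition.denote V s).nat nFlag) =
      coalition V (s.real rLeft 0 0) (s.real rRight 0 0) n ∧
    (formCoalition.denote V s).nat nParts 0 0 =
      (coalition V (s.real rLeft 0 0) (s.real rRight 0 0) n).card := by
  have h1 := flagSet_forAll_one (V := V) nFlag (by decide) s
  have h2 : ∀ a, ((Code.forAll nAgent (.setNat nFlag (.var nAgent) (.const 1))).denote V s).real a
      = s.real a := fun a => denote_real rfl s
  set s₁ := (Code.forAll nAgent (.setNat nFlag (.var nAgent) (.const 1))).denote V s with hs₁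
  have h3 := denote_forAll (V := V) nPass (countFlags ;; refineCode) s₁
    (fun k s' => s'.real rLeft = s.real rLeft ∧ s'.real rRight = s.real rRight ∧
      flagSet n (s'.nat nFlag) = coalition V (s.real rLeft 0 0) (s.real rRight 0 0) k)
    (by simp [h1, h2, coalition])
    (by
      intro k hk s' hks ⟨h1, h2, h3⟩
      refine ⟨by simpa [denote_real (P := refineCode) (a := rLeft) rfl,
          denote_real (P := countFlags) (a := rLeft) rfl] using h1,
        by simpa [denote_real (P := refineCode) (a := rRight) rfl,
          denote_real (P := countFlags) (a := rRight) rfl] using h2, ?_⟩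
      rw [State.setNat_nat_ne _ (by decide), denote_seq, flagSet_refineCode, nParts_countFlags,
        denote_nat (P := countFlags) (a := nFlag) rfl,
        denote_real (P := countFlags) (a := rLeft) rfl,
        denote_real (P := countFlags) (a := rRight) rfl, h1, h2, h3]
      rfl)
  constructor
  · rw [formCoalition, denote_seq, denote_seq, denote_nat (P := countFlags) (a := nFlag) rfl]
    exact h3.2.2
  · rw [formCoalition, denote_seq, denote_seq, nParts_countFlags]
    exact congrArg Finset.card h3.2.2

theorem exists_nPick_pickFlagged {s : State} (h : (flagSet n (s.nat nFlag)).Nonempty) :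
    ∃ p ∈ flagSet n (s.nat nFlag), (pickFlagged.denote V s).nat nPick 0 0 = (p : ℕ) := by
  have := denote_forAll (V := V) nAgent
    (.onlyIf (flagged (.var nAgent)) (.setNat nPick (.const 0) (.var nAgent))) s
    (fun k s' => s'.nat nFlag = s.nat nFlag ∧ ∀ i ∈ flagSet n (s.nat nFlag), (i : ℕ) < k →
      ∃ p ∈ flagSet n (s.nat nFlag), s'.nat nPick 0 0 = (p : ℕ))
    (by simp)
    (by
      intro k hk s' hks ⟨h1, h2⟩
      rw [denote, holds_flagged (i := ⟨k, hk⟩) (by simpa [NatExpr.val] using hks), h1]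
      split_ifs with hF
      · exact ⟨by simpa [denote] using h1, fun i hi hik => ⟨⟨k, hk⟩, hF, by
          simp [denote, NatExpr.val, hks]⟩⟩
      · refine ⟨by simpa using h1, fun i hi hik => ?_⟩
        have : (i : ℕ) ≠ k := by
          rintro rfl; exact hF hi
        simpa using h2 i hi (by omega))
  obtain ⟨i, hi⟩ := h
  exact this.2 i hi i.2

theorem denote_select {s : State} {k : ℕ} (h0 : s.nat 0 0 0 = n) (hk : s.nat nRound 0 0 = k)
    (hR : (flagSet n (s.nat nLeft)).Nonempty) :
    ∃ p ∈ candidates V k (flagSet n (s.nat nLeft)),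
      (select.denote V s).nat nPick 0 0 = (p : ℕ) ∧
      (select.denote V s).nat nParts 0 0 = n ∧ (select.denote V s).real rLeft 0 0 = 0 ∧
      (select.denote V s).real rRight 0 0 = 1 := by
  have h1 := flagSet_forAll_copy (V := V) s
  have h2 : ((Code.forAll nAgent (.setNat nFlag (.var nAgent)
      (.cell nLeft (.var nAgent)))).denote V s).nat 0 = s.nat 0 := denote_nat rfl s
  have h3 : ((Code.forAll nAgent (.setNat nFlag (.var nAgent)
      (.cell nLeft (.var nAgent)))).denote V s).nat nRound = s.nat nRound := denote_nat rfl s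
  rw [select, denote_seq]
  set s₁ := (Code.forAll nAgent (.setNat nFlag (.var nAgent)
      (.cell nLeft (.var nAgent)))).denote V s
  simp only [denote_seq]
  set s₂ := denote V (.setNat nCut (.const 0) (.var nRound))
    (denote V (.setNat nParts (.const 0) (.var 0))
      (denote V (.setReal rRight (.const 1)) (denote V (.setReal rLeft (.const 0)) s₁))) with hs₂
  have hcut : s₂.nat nCut 0 0 = k := by simp [hs₂, denote, NatExpr.val, h3, hk]
  have hparts : s₂.nat nParts 0 0 = n := by simp [hs₂, denote, NatExpr.val, h2, h0]
  have hleft : s₂.real rLeft 0 0 = 0 := by simp [hs₂, denote, RealExpr.val]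
  have hright : s₂.real rRight 0 0 = 1 := by simp [hs₂, denote, RealExpr.val]
  have hflag : flagSet n (s₂.nat nFlag) = flagSet n (s.nat nLeft) := by simpa [hs₂, denote] using h1
  have hF : flagSet n ((denote V refineCode (denote V keepLeast s₂)).nat nFlag) =
      candidates V k (flagSet n (s.nat nLeft)) := by
    rw [flagSet_refineCode, flagSet_keepLeast, denote_real (P := keepLeast) (a := rLeft) rfl,
      denote_real (P := keepLeast) (a := rRight) rfl,
      denote_nat (P := keepLeast) (a := nParts) rfl, hcut, hparts, hleft, hright, hflag]
    rfl
  obtain ⟨p, hp, hps⟩ := exists_nPick_pickFlagged (V := V)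
    (s := denote V refineCode (denote V keepLeast s₂))
    (by rw [hF]; exact candidates_nonempty V k hR)
  refine ⟨p, hF ▸ hp, hps, ?_, ?_, ?_⟩
  · rw [denote_nat (P := pickFlagged) (a := nParts) rfl,
      denote_nat (P := refineCode) (a := nParts) rfl,
      denote_nat (P := keepLeast) (a := nParts) rfl, hparts]
  · rw [denote_real (P := pickFlagged) (a := rLeft) rfl,
      denote_real (P := refineCode) (a := rLeft) rfl,
      denote_real (P := keepLeast) (a := rLeft) rfl, hleft]
  · rw [denote_real (P := pickFlagged) (a := rRight) rfl,
      denote_real (P := refineCode) (a := rRight) rfl,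
      denote_real (P := keepLeast) (a := rRight) rfl, hright]

theorem denote_handOver {s : State} {k : Fin n} (hk : s.nat nAgent 0 0 = k) {w : ℝ}
    (hw : w = if s.nat nParts 0 0 ≤ s.nat nDone 0 0 + 1 then s.real rRight 0 0 else
      cutPt (V k) (s.real rLeft 0 0) (s.real rRight 0 0) (s.nat nParts 0 0)
        (s.nat nDone 0 0 + 1)) :
    (handOver.denote V s).given = s.given ++ [((k : ℕ), s.real rFrom 0 0, w)] ∧
      (handOver.denote V s).real rFrom 0 0 = w ∧
      (handOver.denote V s).nat nDone 0 0 = s.nat nDone 0 0 + 1 := by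
  set s₁ := denote V (.onlyIf (.natLe (.var nParts) (.succ (.var nDone)))
    (.setReal rTo (.var rRight)))
    (denote V (.setReal rTo (cutExpr (.var nAgent) (.succ (.var nDone)))) s) with hs₁
  have hw' : s₁.real rTo 0 0 = w := by
    rw [hs₁, hw]
    set s₂ := denote V (.setReal rTo (cutExpr (.var nAgent) (.succ (.var nDone)))) s with hs₂
    have htest : (Test.natLe (.var nParts) (.succ (.var nDone))).Holds V s₂ ↔
        s.nat nParts 0 0 ≤ s.nat nDone 0 0 + 1 := Iff.rfl
    by_cases h : s.nat nParts 0 0 ≤ s.nat nDone 0 0 + 1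
    · rw [if_pos h, denote, if_pos (htest.2 h)]
      simp [hs₂, denote, RealExpr.val, NatExpr.val]
    · rw [if_neg h, denote, if_neg (mt htest.1 h), hs₂, denote, State.setReal_real_self,
        val_cutExpr (p := k) (by simpa [NatExpr.val] using hk)]
      simp [NatExpr.val]
  have h1 : s₁.real rFrom = s.real rFrom := by
    rw [hs₁, denote_real rfl, denote_real rfl]
  have h2 : ∀ a, s₁.nat a = s.nat a := fun a => by
    rw [hs₁, denote_nat rfl, denote_nat rfl]
  have h3 : s₁.given = s.given := by
    rw [hs₁, denote_given rfl, denote_given rfl]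
  rw [handOver, denote_seq, denote_seq, ← hs₁]
  clear_value s₁
  simp [denote, NatExpr.val, RealExpr.val, hw', h1, h2, h3, hk]

/-- `distribute` hands the interval over to the final coalition, whose members all receive the same
fraction of their values for it. -/
theorem denote_distribute [NeZero n] (hV : ∀ i, IsValuation (V i)) {s : State} {a b : ℝ}
    (ha : s.real rLeft 0 0 = a) (hb : s.real rRight 0 0 = b) (ha0 : 0 ≤ a) (hab : a ≤ b)
    (hb1 : b ≤ 1) (hflag : flagSet n (s.nat nFlag) = coalition V a b n)
    (hparts : s.nat nParts 0 0 = (coalition V a b n).card) :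
    ∃ L, (distribute.denote V s).given = s.given ++ L ∧ Chain n a L b ∧
      ∀ i : Fin n, worth (V i) i L = bonus V a b i := by
  obtain ⟨i₀, hi₀⟩ := coalition_nonempty V a b n
  set C := coalition V a b n with hC
  have hCn : C.card ≤ n := by simpa using C.card_le_univ
  -- the common cuts of the members of the coalition
  set c : ℕ → ℝ := fun l => cutPt (V i₀) a b C.card l with hc
  have hcommon : ∀ i ∈ C, ∀ l ≤ n, cutPt (V i) a b C.card l = c l := by
    intro i hi l hl
    cases l with
    | zero =>
      rw [hc, cutPt_zero _ ha0 (hab.trans hb1)]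
      exact (cutPt_zero _ ha0 (hab.trans hb1)).symm
    | succ l => exact cutPt_eq_of_mem_coalition V hi hi₀ hl
  set d : ℕ → ℕ := fun k => (C.filter fun i : Fin n => (i : ℕ) < k).card with hd
  have hdn : d n = C.card := by rw [hd]; exact congrArg Finset.card (filter_lt_self C)
  have hloop := denote_forAll (V := V) nAgent (.onlyIf (flagged (.var nAgent)) handOver)
    (denote V (.setReal rFrom (.var rLeft)) (denote V (.setNat nDone (.const 0) (.const 0)) s))
    (fun k s' => s'.nat nFlag = s.nat nFlag ∧ s'.nat nParts = s.nat nParts ∧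
      s'.real rLeft = s.real rLeft ∧ s'.real rRight = s.real rRight ∧
      s'.nat nDone 0 0 = d k ∧ ∃ L, s'.given = s.given ++ L ∧
        Chain n a L (s'.real rFrom 0 0) ∧
        s'.real rFrom 0 0 = (if d k = C.card then b else c (d k)) ∧
        ∀ i : Fin n, worth (V i) i L =
          if i ∈ C ∧ (i : ℕ) < k then evalQuery (V i) a b / C.card else 0)
    (by
      have hd0 : d 0 = 0 := by simp [hd]
      have hc0 : c 0 = a := cutPt_zero _ ha0 (hab.trans hb1)
      have hCpos : C.card ≠ 0 := (Finset.card_pos.2 ⟨i₀, hi₀⟩).ne'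
      refine ⟨by simp [denote], by simp [denote], by simp [denote], by simp [denote],
        by simp [denote, NatExpr.val, hd0], [], by simp [denote], ?_, ?_, by simp⟩
      · simp [Chain, denote, RealExpr.val, NatExpr.val, ha]
      · simp [denote, RealExpr.val, NatExpr.val, ha, hd0, hc0, hCpos.symm])
    (by
      rintro k hk s' hks ⟨h1, h2, h3, h4, h5, L, hL, hchain, hfrom, hworth⟩
      have hd1 : d (k + 1) = d k + if ⟨k, hk⟩ ∈ C then 1 else 0 := card_filter_lt_succ C hk
      have htest := holds_flagged (V := V) (s := s') (e := .var nAgent) (i := ⟨k, hk⟩)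
        (by simpa [NatExpr.val] using hks)
      rw [h1, hflag] at htest
      by_cases hkC : (⟨k, hk⟩ : Fin n) ∈ C
      · rw [if_pos hkC] at hd1
        have hdk : d k + 1 ≤ C.card := by
          rw [← hd1]; exact Finset.card_filter_le _ _
        set w : ℝ := if C.card ≤ d k + 1 then b else c (d k + 1) with hw
        obtain ⟨g1, g2, g3⟩ := denote_handOver (V := V) (s := s') (k := ⟨k, hk⟩) hks (w := w) (by
          rw [h2, h3, h4, h5, ha, hb, hparts, hcommon _ hkC _ (hdk.trans hCn)])
        have hfrom' : s'.real rFrom 0 0 = c (d k) := by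
          rw [hfrom, if_neg (by omega)]
        rw [hfrom'] at hchain g1
        have : IsFiniteMeasure (V ⟨k, hk⟩) := (hV _).1
        have : NullSingletonClass (V ⟨k, hk⟩) := (hV _).2
        have hcw : c (d k) ≤ w := by
          rw [hw]
          split_ifs
          · exact cutPt_le _ ha0 hab hb1 (by omega)
          · exact cutPt_mono _ (by omega)
        have hval : evalQuery (V ⟨k, hk⟩) (c (d k)) w =
            evalQuery (V ⟨k, hk⟩) a b / C.card := by
          rw [hw, ← hcommon _ hkC _ ((Nat.le_of_succ_le hdk).trans hCn)]
          split_ifs with hlast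
          · exact evalQuery_cutPt_last _ ha0 hab hb1 (by omega)
          · rw [← hcommon _ hkC _ (hdk.trans hCn)]
            exact evalQuery_cutPt_succ _ ha0 hab hb1 hdk
        have hden : denote V (.onlyIf (flagged (.var nAgent)) handOver) s' =
            handOver.denote V s' := by rw [denote, if_pos (htest.2 hkC)]
        rw [hden]
        refine ⟨by simpa [denote_nat (P := handOver) (a := nFlag) rfl] using h1,
          by simpa [denote_nat (P := handOver) (a := nParts) rfl] using h2,
          by simpa [denote_real (P := handOver) (a := rLeft) rfl] using h3,
          by simpa [denote_real (P := handOver) (a := rRight) rfl] using h4,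
          by simp [g3, h5, hd1], L ++ [(k, c (d k), w)], ?_, ?_, ?_, ?_⟩
        · simp [g1, hL]
        · simpa [g2] using hchain.append (Chain.singleton hk hcw)
        · rw [State.setNat_real, g2, hw, hd1]
          congr 1
          exact propext ⟨fun h => by omega, fun h => by omega⟩
        · intro i
          rw [worth_append, hworth, worth_singleton]
          by_cases hik : i = ⟨k, hk⟩
          · subst hik
            simp [hkC, hval]
          · have hne : (i : ℕ) ≠ k := fun h => hik (Fin.ext h)
            rw [if_neg (Ne.symm hne), add_zero]
            congr 1
            exact propext (and_congr_right fun _ => by omega)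
      · rw [if_neg hkC, add_zero] at hd1
        have hden : denote V (.onlyIf (flagged (.var nAgent)) handOver) s' = s' := by
          rw [denote, if_neg fun h => hkC (htest.1 h)]
        rw [hden]
        refine ⟨by simpa using h1, by simpa using h2, by simpa using h3, by simpa using h4,
          by simp [h5, hd1], L, by simpa using hL, by simpa using hchain,
          by rw [hd1]; simpa using hfrom, fun i => ?_⟩
        rw [hworth]
        congr 1
        refine propext (and_congr_right fun hi => ?_)
        have : (i : ℕ) ≠ k := by
          rintro rfl; exact hkC hi
        omega)
  obtain ⟨-, -, -, -, -, L, hL, hchain, hfrom, hworth⟩ := hloop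
  rw [if_pos hdn] at hfrom
  rw [hfrom] at hchain
  refine ⟨L, hL, hchain, fun i => ?_⟩
  rw [hworth, bonus]
  simp [← hC]

theorem denote_divideGap [NeZero n] (hV : ∀ i, IsValuation (V i)) {s : State} {a b : ℝ}
    (ha : s.real rLeft 0 0 = a) (hb : s.real rRight 0 0 = b) (ha0 : 0 ≤ a) (hab : a ≤ b)
    (hb1 : b ≤ 1) :
    ∃ L, (divideGap.denote V s).given = s.given ++ L ∧ Chain n a L b ∧
      ∀ i : Fin n, worth (V i) i L = bonus V a b i := by
  have h := flagSet_formCoalition (V := V) s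
  rw [ha, hb] at h
  have := denote_distribute hV (s := formCoalition.denote V s) (a := a) (b := b)
    (by rw [denote_real rfl, ha]) (by rw [denote_real rfl, hb]) ha0 hab hb1 h.1 h.2
  rwa [denote_given (P := formCoalition) rfl] at this

/-! ### Correctness of the protocol -/

/-- The invariant of the protocol after `k` rounds. -/
def Served (V : Fin n → Measure unitInterval) (k : ℕ) (s : State) : Prop :=
  s.nat 0 0 0 = n ∧ ∃ e, PickRun V k (flagSet n (s.nat nLeft)) (s.real rFree 0 0) e ∧
    Chain n 0 s.given (s.real rFree 0 0) ∧
    ∀ i : Fin n, worth (V i) i s.given =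
      (if i ∈ flagSet n (s.nat nLeft) then 0 else (V i).real univ / n) + e i

theorem Served.serve [NeZero n] (hV : ∀ i, IsValuation (V i)) {k : ℕ} (hk : k < n) {s : State}
    (hks : s.nat nRound 0 0 = k) (h : Served V k s) :
    Served V (k + 1) (serve.denote V s) := by
  obtain ⟨h0, e, hrun, hchain, hworth⟩ := h
  set R := flagSet n (s.nat nLeft) with hR
  set x := s.real rFree 0 0 with hx
  have hRne : R.Nonempty := Finset.card_pos.1 (by have := hrun.card_add; omega)
  obtain ⟨p, hp, hpick, hparts, hleft, hright⟩ := denote_select (V := V) h0 hks hRne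
  have hpR : p ∈ R := leastBy_subset _ _ (candidates_subset V _ _ hp)
  have : IsFiniteMeasure (V p) := (hV _).1
  have : NullSingletonClass (V p) := (hV _).2
  set u := cutPt (V p) 0 1 n k with hu
  set v := cutPt (V p) 0 1 n (k + 1) with hv
  have hxu : x ≤ u := hrun.le_cutPt hpR
  have huv : u ≤ v := cutPt_mono _ (Nat.le_succ k)
  have hu1 : u ≤ 1 := markQuery_le_one _ _ _
  set s₁ := select.denote V s with hs₁
  have hround₁ : s₁.nat nRound 0 0 = k := by rw [hs₁, denote_nat rfl, hks]
  have hfree₁ : s₁.real rFree 0 0 = x := by rw [hs₁, denote_real rfl]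
  set s₂ := denote V (.setReal rLeft (.var rFree))
    (denote V (.setReal rRight (cutExpr (.var nPick) (.var nRound)))
      (denote V (.setReal rNext (cutExpr (.var nPick) (.succ (.var nRound)))) s₁)) with hs₂
  have hnat₂ : s₂.nat = s₁.nat := rfl
  have hgiven₂ : s₂.given = s.given := by
    rw [hs₂, denote_given rfl, denote_given rfl, denote_given rfl, hs₁, denote_given rfl]
  have hleft₂ : s₂.real rLeft 0 0 = x := by
    simp [hs₂, denote, RealExpr.val, NatExpr.val, hfree₁]
  have hright₂ : s₂.real rRight 0 0 = u := by
    simp only [hs₂, denote]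
    rw [State.setReal_real_ne _ (by decide), State.setReal_real_self,
      val_cutExpr (p := p) (by simpa [NatExpr.val] using hpick)]
    simp [NatExpr.val, hparts, hleft, hright, hround₁, hu]
  have hnext₂ : s₂.real rNext 0 0 = v := by
    simp only [hs₂, denote]
    rw [State.setReal_real_ne _ (by decide), State.setReal_real_ne _ (by decide),
      State.setReal_real_self, val_cutExpr (p := p) (by simpa [NatExpr.val] using hpick)]
    simp [NatExpr.val, hparts, hleft, hright, hround₁, hv]
  obtain ⟨L, hL, hLchain, hLworth⟩ :=
    denote_divideGap hV hleft₂ hright₂ hrun.mem_Icc.1 hxu hu1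
  set s₃ := divideGap.denote V s₂ with hs₃
  have hpick₃ : s₃.nat nPick 0 0 = p := by rw [hs₃, denote_nat rfl, hnat₂, hpick]
  have hright₃ : s₃.real rRight 0 0 = u := by rw [hs₃, denote_real rfl, hright₂]
  have hnext₃ : s₃.real rNext 0 0 = v := by rw [hs₃, denote_real rfl, hnext₂]
  have hnum₃ : s₃.nat 0 0 0 = n := by rw [hs₃, denote_nat rfl, hnat₂, hs₁, denote_nat rfl, h0]
  have hR₃ : flagSet n (s₃.nat nLeft) = R := by
    rw [hs₃, denote_nat rfl, hnat₂, hs₁, denote_nat rfl]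
  set s₄ := CakeCutting.serve.denote V s with hs₄
  have hs₄' : s₄ = ((s₃.give p u v).setReal rFree 0 0 v).setNat nLeft p 0 0 := by
    have : s₄ = denote V (.setNat nLeft (.var nPick) (.const 0))
      (denote V (.setReal rFree (.var rNext))
        (denote V (.give (.var nPick) (.var rRight) (.var rNext)) s₃)) := rfl
    rw [this]
    simp [denote, NatExpr.val, RealExpr.val, hpick₃, hright₃, hnext₃]
  have hflag₄ : flagSet n (s₄.nat nLeft) = R.erase p := by
    rw [hs₄', flagSet_setNat_zero]
    simp [hR₃]
  have hfree₄ : s₄.real rFree 0 0 = v := by simp [hs₄']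
  have hgiven₄ : s₄.given = s.given ++ L ++ [((p : ℕ), u, v)] := by simp [hs₄', hL, hgiven₂]
  refine ⟨by simp [hs₄', hnum₃], fun i => e i + bonus V x u i, ?_, ?_, ?_⟩
  · rw [hflag₄, hfree₄]
    exact .step hrun hp
  · rw [hgiven₄, hfree₄]
    exact (hchain.append hLchain).append (Chain.singleton p.2 huv)
  · intro i
    rw [hgiven₄, hflag₄, worth_append, worth_append, hworth, hLworth, worth_singleton]
    by_cases hip : i = p
    · subst hip
      rw [if_pos hpR, if_pos rfl, if_neg (Finset.notMem_erase _ _), hu, hv,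
        evalQuery_cutPt_succ _ le_rfl zero_le_one le_rfl hk, evalQuery_zero_one]
      ring
    · rw [if_neg (fun h => hip (Fin.ext h).symm)]
      simp only [Finset.mem_erase, hip, ne_eq, not_false_eq_true, true_and]
      ring

theorem denote_protocol [NeZero n] (hV : ∀ i, IsValuation (V i)) :
    ∃ x e, PickRun V n ∅ x e ∧ Chain n 0 (protocol.denote V (State.init n)).given 1 ∧
      ∀ i : Fin n, worth (V i) i (protocol.denote V (State.init n)).given =
        (V i).real univ / n + e i + bonus V x 1 i := by
  set s₁ := (Code.forAll nAgent (.setNat nLeft (.var nAgent) (.const 1))).denote V (State.init n)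
    with hs₁
  have hflag : flagSet n (s₁.nat nLeft) = Finset.univ :=
    flagSet_forAll_one nLeft (by decide) (State.init n)
  have hnum : s₁.nat 0 0 0 = n := by
    rw [hs₁, denote_nat rfl]; simp [State.init]
  have hgiven : s₁.given = [] := by rw [hs₁, denote_given rfl]; rfl
  set s₂ := denote V (.setReal rFree (.const 0)) s₁ with hs₂
  have hfree₂ : s₂.real rFree 0 0 = 0 := by simp [hs₂, denote, RealExpr.val]
  have hloop := denote_forAll (V := V) nRound serve s₂ (Served V)
    (by
      refine ⟨by simp [hs₂, denote, hnum], fun _ => 0, ?_, ?_, ?_⟩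
      · simpa [hs₂, denote, RealExpr.val, hflag] using PickRun.zero (V := V)
      · simp [hs₂, denote, RealExpr.val, hgiven, Chain]
      · simp [hs₂, denote, hgiven, hflag])
    (fun k hk s hks h => by
      obtain ⟨h1, e, h2⟩ := h.serve hV hk hks
      exact ⟨by simpa using h1, e, by simpa using h2⟩)
  set s₃ := (Code.forAll nRound serve).denote V s₂
  obtain ⟨-, e, hrun, hchain, hworth⟩ := hloop
  have hempty : flagSet n (s₃.nat nLeft) = ∅ :=
    Finset.card_eq_zero.1 (by have := hrun.card_add; omega)
  rw [hempty] at hrun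
  set x := s₃.real rFree 0 0 with hx
  set s₄ := denote V (.setReal rRight (.const 1)) (denote V (.setReal rLeft (.var rFree)) s₃)
    with hs₄
  obtain ⟨L, hL, hLchain, hLworth⟩ := denote_divideGap hV (s := s₄) (a := x) (b := 1)
    (by simp [hs₄, denote, RealExpr.val, NatExpr.val, hx]) (by simp [hs₄, denote, RealExpr.val])
    hrun.mem_Icc.1 hrun.mem_Icc.2 le_rfl
  have hfinal : (protocol.denote V (State.init n)).given = s₃.given ++ L := hL
  refine ⟨x, e, hrun, ?_, fun i => ?_⟩
  · rw [hfinal]; exact hchain.append hLchain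
  · rw [hfinal, worth_append, hworth, hLworth, hempty]
    simp

theorem exec_protocol (V : Fin n → Measure unitInterval) :
    ∃ t, Exec V protocol.compile (State.init n) (protocol.denote V (State.init n)) t ∧
      t ≤ protocol.bound.eval n :=
  exec_compile rfl rfl (by simp [State.init])

/-- The value of each agent is determined by data that do not depend on the order of the agents. -/
theorem real_share_protocol (hn : 1 ≤ n) (hV : ∀ i, IsValuation (V i)) :
    ∃ x e, PickRun V n ∅ x e ∧ ∀ i : Fin n,
      (V i).real ((protocol.denote V (State.init n)).share i) =
        (V i).real univ / n + e i + bonus V x 1 i := by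
  have : NeZero n := ⟨by omega⟩
  obtain ⟨x, e, hrun, hchain, hworth⟩ := denote_protocol hV
  refine ⟨x, e, hrun, fun i => ?_⟩
  have : IsFiniteMeasure (V i) := (hV _).1
  have : NullSingletonClass (V i) := (hV _).2
  rw [← hworth]
  exact hchain.real_shareOf le_rfl (V i) i

theorem isSymmetric_protocol : IsSymmetric protocol.compile := by
  rintro n V hn hV σ Z Z' t t' ⟨s, hs, hZ⟩ ⟨s', hs', hZ'⟩ j
  obtain ⟨u, hu, -⟩ := exec_protocol V
  obtain ⟨u', hu', -⟩ := exec_protocol fun j => V (σ j)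
  obtain ⟨rfl, -⟩ := hs.deterministic hu
  obtain ⟨rfl, -⟩ := hs'.deterministic hu'
  obtain ⟨x, e, hrun, hval⟩ := real_share_protocol hn hV
  obtain ⟨x', e', hrun', hval'⟩ := real_share_protocol hn fun j => hV (σ j)
  obtain ⟨rfl, -, he⟩ := hrun.perm σ hrun'
  rw [hZ, hZ', hval, hval' j, he, bonus_perm]

end CakeCutting

end

theorem theorem4 :
    ∃ (P : CakeCutting.Program) (p : Polynomial ℕ),
      CakeCutting.IsSymmetric P ∧
      ∀ (n : ℕ) (V : Fin n → MeasureTheory.Measure unitInterval), 1 ≤ n →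
        (∀ i, CakeCutting.IsValuation (V i)) →
        ∃ (Z : Fin n → Set unitInterval) (t : ℕ),
          CakeCutting.Allocates P V Z t ∧ t ≤ p.eval n ∧
          CakeCutting.IsPartition Z ∧ CakeCutting.IsProportional V Z := by
  refine ⟨CakeCutting.protocol.compile, CakeCutting.protocol.bound,
    CakeCutting.isSymmetric_protocol, fun n V hn hV => ?_⟩
  have : NeZero n := ⟨by omega⟩
  obtain ⟨t, ht, htb⟩ := CakeCutting.exec_protocol V
  obtain ⟨_, _, -, hchain, -⟩ := CakeCutting.denote_protocol hV
  refine ⟨fun i => (CakeCutting.protocol.denote V (CakeCutting.State.init n)).share i, t,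
    ⟨_, ht, fun _ => rfl⟩, htb, ⟨fun i j hij => ?_, ?_⟩, fun i => ?_⟩
  · exact hchain.disjoint_shareOf le_rfl fun h => hij (Fin.ext h)
  · exact univ_subset_iff.1 (CakeCutting.piece_zero_one ▸ hchain.piece_subset le_rfl)
  · obtain ⟨x, e, hrun, hval⟩ := CakeCutting.real_share_protocol hn hV
    rw [hval]
    linarith [hrun.nonneg i, CakeCutting.bonus_nonneg V x 1 i]
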